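/- Let $X$ be a smooth manifold. For $E_j=v_j+\eta_j\in T_xX\oplus T^*_xX$ let $\langle E_1,E_2\rangle=\tfrac12(\eta_1(v_2)+\eta_2(v_1))$ be the natural pairing. A generalized complex structure on $X$ is a smooth section $\mathcal J$ of $\mathrm{SO}(TX\oplus T^*X)$ with $\mathcal J^2=-\mathrm{id}$ whose $(-\sqrt{-1})$-eigenbundle $L_{\mathcal J}\subset(TX\oplus T^*X)^{\mathbb C}$ is involutive with respect to the Courant bracket $$[u+\xi,v+\eta]_c=[u,v]+\tfrac12\left(\mathcal L_u\eta-\mathcal L_v\xi-i_vd\xi+i_ud\eta\right).$$ A generalized Kähler structure is a pair $(\mathcal J_0,\mathcal J_1)$ of commuting generalized complex structures such that $G=-\mathcal J_0\mathcal J_1$ is a generalized metric, i.e. a section of $\mathrm{SO}(TX\oplus T^*X)$ with $G^2=\mathrm{id}$ for which $\langle GE_1,E_2\rangle$ is a positive-definite metric. Let $i:M\to X$ be a (possibly immersed) submanifold with conormal bundle $N^*\subset T^*X|_M$, and let $p=\mathrm{id}\oplus i^*:TM\oplus T^*X|_M\to TM\oplus T^*M$. For a generalized complex structure $\mathcal J$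 put $L_{\mathcal J}(M)=L_{\mathcal J}\cap(TM\oplus T^*X|_M)^{\mathbb C}$ and $L_{\mathcal J}(N^*)=L_{\mathcal J}\cap(N^*)^{\mathbb C}$. Call $M$ a $\mathcal J$-submanifold if $L_{\mathcal J}(M)$ and $L_{\mathcal J}(N^*)$ are smooth subbundles and $$0\to L_{\mathcal J}(N^*)\oplus\overline{L_{\mathcal J}(N^*)}\to L_{\mathcal J}(M)\oplus\overline{L_{\mathcal J}(M)}\xrightarrow{\ q\ }(TM\oplus T^*M)^{\mathbb C}\to0$$ is exact, where $q$ is the restriction of $p$. The induced structure $\mathcal J_M$ on $TM\oplus T^*M$ is then the one defined on the quotient, i.e. $\mathcal J_M\circ q=q\circ\mathcal J$ on $L_{\mathcal J}(M)\oplus\overline{L_{\mathcal J}(M)}$. **Theorem.** Let $(\mathcal J_0,\mathcal J_1)$ be a generalized Kähler structure on $X$, and suppose that the conormal bundle of $M$ is $\mathcal J_0$-invariant, $\mathcal J_0(N^*)=N^*$. Then $M$ is a $\mathcal J_0$-submanifold and also a $\mathcal J_1$-submanifold (that is, $M$ is a generalized Kähler submanifold); the induced structures $\mathcal J_{0,M}$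 and $\mathcal J_{1,M}$ exist and are unique, and $(\mathcal J_{0,M},\mathcal J_{1,M})$ is a generalized Kähler structure on $M$. -/

import Mathlib

open scoped Manifold ContDiff Topology TensorProduct
open Bundle

noncomputable section

namespace GenKahler

/-! ## Complexification of a real vector space -/

section Complexification

/-- Complex conjugation on the complexification `ℂ ⊗[ℝ] V`, as a conjugate-linear map. -/
def conjC (V : Type*) [AddCommGroup V] [Module ℝ V] :
    (ℂ ⊗[ℝ] V) →ₛₗ[starRingEnd ℂ] (ℂ ⊗[ℝ] V) where
  toFun := TensorProduct.map (Complex.conjAe.toLinearMap) (LinearMap.id : V →ₗ[ℝ] V)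
  map_add' := map_add _
  map_smul' := by
    intro c z
    induction z using TensorProduct.induction_on with
    | zero => simp
    | tmul a v => simp [TensorProduct.smul_tmul']
    | add z w hz hw => simp only [smul_add, map_add, hz, hw]

/-- The element `a + √-1 b` of the complexification, for real vectors `a` and `b`. -/
def cplx {V : Type*} [AddCommGroup V] [Module ℝ V] (a b : V) : ℂ ⊗[ℝ] V :=
  (1 : ℂ) ⊗ₜ[ℝ] a + Complex.I ⊗ₜ[ℝ] b

/-- The complex conjugate `S̄` of a complex subspace `S` of the complexification of `V`. -/
def conjSub {V : Type*} [AddCommGroup V] [Module ℝ V] (S : Submodule ℂ (ℂ ⊗[ℝ] V)) :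
    Submodule ℂ (ℂ ⊗[ℝ] V) :=
  S.map (conjC V)

end Complexification

/-! ## Sections of `TX ⊕ T*X` and the Courant bracket

`X` is a smooth manifold modelled on the real normed space `E` (finite-dimensional in the
theorem). -/

section Manifold

variable {E : Type*} [NormedAddCommGroup E] [NormedSpace ℝ E]
  {X : Type*} [TopologicalSpace X] [ChartedSpace E X]

/-- The tangent space `T_x X`. -/
abbrev Tan (E : Type*) [NormedAddCommGroup E] [NormedSpace ℝ E]
    {X : Type*} [TopologicalSpace X] [ChartedSpace E X] (x : X) : Type _ :=
  TangentSpace 𝓘(ℝ, E) x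

/-- The cotangent space `T*_x X`. -/
abbrev Cot (E : Type*) [NormedAddCommGroup E] [NormedSpace ℝ E]
    {X : Type*} [TopologicalSpace X] [ChartedSpace E X] (x : X) : Type _ :=
  TangentSpace 𝓘(ℝ, E) x →L[ℝ] ℝ

/-- The fibre `T_x X ⊕ T*_x X` of the generalized tangent bundle. -/
abbrev GT (E : Type*) [NormedAddCommGroup E] [NormedSpace ℝ E]
    {X : Type*} [TopologicalSpace X] [ChartedSpace E X] (x : X) : Type _ :=
  Tan E x × Cot E x

/-- `v` is a smooth vector field along the map `i : Y → X`, over the set `U ⊆ Y`: a smooth section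
of `i⁻¹ TX`. For `i = id` it is an ordinary smooth vector field on `U`. -/
def SmoothVecAlong {F Y : Type*} [NormedAddCommGroup F] [NormedSpace ℝ F] [TopologicalSpace Y]
    [ChartedSpace F Y] [IsManifold 𝓘(ℝ, E) ∞ X] (i : Y → X) (U : Set Y)
    (v : ∀ y : Y, Tan E (i y)) : Prop :=
  ContMDiffOn 𝓘(ℝ, F) (𝓘(ℝ, E).prod 𝓘(ℝ, E)) ∞
    (fun y ↦ (TotalSpace.mk' E (E := fun x : X ↦ TangentSpace 𝓘(ℝ, E) x) (i y) (v y))) U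

/-- `ξ` is a smooth `1`-form along the map `i : Y → X`, over the set `U ⊆ Y`: a smooth section of
`i⁻¹ T*X`. For `i = id` it is an ordinary smooth `1`-form on `U`. -/
def SmoothCovAlong {F Y : Type*} [NormedAddCommGroup F] [NormedSpace ℝ F] [TopologicalSpace Y]
    [ChartedSpace F Y] [IsManifold 𝓘(ℝ, E) ∞ X] (i : Y → X) (U : Set Y)
    (ξ : ∀ y : Y, Cot E (i y)) : Prop :=
  ContMDiffOn 𝓘(ℝ, F) (𝓘(ℝ, E).prod 𝓘(ℝ, E →L[ℝ] ℝ)) ∞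
    (fun y ↦ (TotalSpace.mk' (E →L[ℝ] ℝ)
      (E := fun x : X ↦ TangentSpace 𝓘(ℝ, E) x →L[ℝ] Trivial X ℝ x) (i y) (ξ y))) U

/-- `s` is a smooth section of `TX ⊕ T*X` over `U`. -/
def SmoothGT [IsManifold 𝓘(ℝ, E) ∞ X] (U : Set X) (s : ∀ x : X, GT E x) : Prop :=
  SmoothVecAlong (F := E) (fun x : X ↦ x) U (fun x ↦ (s x).1) ∧
    SmoothCovAlong (F := E) (fun x : X ↦ x) U (fun x ↦ (s x).2)

/-- The `1`-form `i_a dη` at `x`, where `η` is a `1`-form and `a ∈ T_x X`. In the chart `φ` at `x`,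
`dη (a, b) = D_a η (b) - D_b η (a)`. -/
def iotaD (η : ∀ x : X, Cot E x) (x : X) (a : Tan E x) : Cot E x :=
  let φ := extChartAt 𝓘(ℝ, E) x
  let ηφ : E → (E →L[ℝ] ℝ) :=
    fun y ↦ (η (φ.symm y)).comp (mfderiv 𝓘(ℝ, E) 𝓘(ℝ, E) φ.symm y)
  let A : E →L[ℝ] E →L[ℝ] ℝ := fderiv ℝ ηφ (φ x)
  let dφ : TangentSpace 𝓘(ℝ, E) x →L[ℝ] E := mfderiv 𝓘(ℝ, E) 𝓘(ℝ, E) φ x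
  (A (dφ a) - A.flip (dφ a)).comp dφ

/-- The differential `df` at `x` of a real function `f`. -/
def dFun (f : X → ℝ) (x : X) : Cot E x :=
  (mfderiv 𝓘(ℝ, E) 𝓘(ℝ, ℝ) f x : TangentSpace 𝓘(ℝ, E) x →L[ℝ] ℝ)

/-- The Lie derivative `L_u η = i_u dη + d (i_u η)` of a `1`-form `η` along a vector field `u`. -/
def lieD (u : ∀ x : X, Tan E x) (η : ∀ x : X, Cot E x) (x : X) : Cot E x :=
  iotaD η x (u x) + dFun (fun y ↦ η y (u y)) x

/-- The Courant bracket
`[u + ξ, v + η]_c = [u, v] + 1/2 (L_u η - L_v ξ - i_v dξ + i_u dη)`. -/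
def courant (s t : ∀ x : X, GT E x) (x : X) : GT E x :=
  let u := fun y ↦ (s y).1
  let ξ := fun y ↦ (s y).2
  let v := fun y ↦ (t y).1
  let η := fun y ↦ (t y).2
  (VectorField.mlieBracket 𝓘(ℝ, E) u v x,
    (1 / 2 : ℝ) • (lieD u η x - lieD v ξ x - iotaD ξ x (v x) + iotaD η x (u x)))

/-- The natural pairing `⟨u + ξ, v + η⟩ = 1/2 (ξ(v) + η(u))` on `T_x X ⊕ T*_x X`. -/
def pairing {x : X} (e₁ e₂ : GT E x) : ℝ := (1 / 2 : ℝ) * (e₁.2 e₂.1 + e₂.2 e₁.1)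

/-! ## Generalized complex structures, generalized metrics, generalized Kähler structures -/

/-- A (not necessarily smooth) field of endomorphisms of `TX ⊕ T*X`. -/
abbrev EndField (E X : Type*) [NormedAddCommGroup E] [NormedSpace ℝ E]
    [TopologicalSpace X] [ChartedSpace E X] : Type _ :=
  ∀ x : X, Module.End ℝ (GT E x)

/-- `J` is a smooth section of `SO(TX ⊕ T*X)`: it is fibrewise orthogonal for the natural pairing
with determinant one, and smooth (it maps smooth local sections of `TX ⊕ T*X` to smooth local
sections). -/
structure IsSOSection [IsManifold 𝓘(ℝ, E) ∞ X] (J : EndField E X) : Prop where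
  orthogonal : ∀ (x : X) (e₁ e₂ : GT E x), pairing (J x e₁) (J x e₂) = pairing e₁ e₂
  det_eq_one : ∀ x : X, LinearMap.det (J x) = 1
  smooth : ∀ U : Set X, IsOpen U → ∀ s : ∀ x : X, GT E x,
    SmoothGT U s → SmoothGT U (fun x ↦ J x (s x))

/-- The `(-√-1)`-eigenspace `L_J` of `J` in `(T_x X ⊕ T*_x X) ⊗ ℂ`. -/
def eigenL (J : EndField E X) (x : X) : Submodule ℂ (ℂ ⊗[ℝ] GT E x) :=
  Module.End.eigenspace ((J x).baseChange ℂ) (-Complex.I)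

/-- `L_J` is involutive: for smooth local sections `a + √-1 b` and `c + √-1 d` of `L_J` (with
`a, b, c, d` local sections of `TX ⊕ T*X`), their Courant bracket, extended complex bilinearly, is
a section of `L_J`. -/
def Involutive [IsManifold 𝓘(ℝ, E) ∞ X] (J : EndField E X) : Prop :=
  ∀ U : Set X, IsOpen U → ∀ a b c d : ∀ x : X, GT E x,
    SmoothGT U a → SmoothGT U b → SmoothGT U c → SmoothGT U d →
    (∀ x ∈ U, cplx (a x) (b x) ∈ eigenL J x) →
    (∀ x ∈ U, cplx (c x) (d x) ∈ eigenL J x) →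
    ∀ x ∈ U, cplx (courant a c x - courant b d x) (courant a d x + courant b c x) ∈ eigenL J x

/-- A generalized complex structure: a section `J` of `SO(TX ⊕ T*X)` with `J² = -id` whose
`(-√-1)`-eigenbundle is involutive. -/
structure IsGeneralizedComplex [IsManifold 𝓘(ℝ, E) ∞ X] (J : EndField E X) : Prop where
  so : IsSOSection J
  sq : ∀ x : X, J x * J x = -1
  involutive : Involutive J

/-- A generalized metric: a section `G` of `SO(TX ⊕ T*X)` with `G² = id` such that
`⟨G e₁, e₂⟩` is a positive-definite (symmetric) bilinear form. -/
structure IsGeneralizedMetric [IsManifold 𝓘(ℝ, E) ∞ X] (G : EndField E X) : Prop where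
  so : IsSOSection G
  sq : ∀ x : X, G x * G x = 1
  symm : ∀ (x : X) (e₁ e₂ : GT E x), pairing (G x e₁) e₂ = pairing (G x e₂) e₁
  pos : ∀ (x : X) (e : GT E x), e ≠ 0 → 0 < pairing (G x e) e

/-- A generalized Kähler structure: two commuting generalized complex structures such that
`G = -J₀ J₁` is a generalized metric. -/
structure IsGeneralizedKahler [IsManifold 𝓘(ℝ, E) ∞ X] (J₀ J₁ : EndField E X) : Prop where
  complex₀ : IsGeneralizedComplex J₀
  complex₁ : IsGeneralizedComplex J₁
  comm : ∀ x : X, J₀ x * J₁ x = J₁ x * J₀ x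
  metric : IsGeneralizedMetric (fun x ↦ -(J₀ x * J₁ x))

/-! ## Submanifolds

`i : M → X` is a smooth immersion between manifolds modelled on `F` and `E`. -/

variable {F : Type*} [NormedAddCommGroup F] [NormedSpace ℝ F]
  {M : Type*} [TopologicalSpace M] [ChartedSpace F M]

/-- The fibre of `TM ⊕ T*X|_M` at `m`. -/
abbrev RT (F E : Type*) [NormedAddCommGroup F] [NormedSpace ℝ F] [NormedAddCommGroup E]
    [NormedSpace ℝ E] {M X : Type*} [TopologicalSpace M] [ChartedSpace F M] [TopologicalSpace X]
    [ChartedSpace E X] (i : M → X) (m : M) : Type _ :=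
  Tan F m × Cot E (i m)

/-- The differential `T_m M → T_{i(m)} X`. -/
def dmap (F E : Type*) [NormedAddCommGroup F] [NormedSpace ℝ F] [NormedAddCommGroup E]
    [NormedSpace ℝ E] {M X : Type*} [TopologicalSpace M] [ChartedSpace F M] [TopologicalSpace X]
    [ChartedSpace E X] (i : M → X) (m : M) : Tan F m →L[ℝ] Tan E (i m) :=
  mfderiv 𝓘(ℝ, F) 𝓘(ℝ, E) i m

/-- The inclusion `TM ⊕ T*X|_M → (TX ⊕ T*X)|_M`, `u + ξ ↦ i_* u + ξ`. -/
def incl (i : M → X) (m : M) : RT F E i m →ₗ[ℝ] GT E (i m) :=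
  LinearMap.prodMap (dmap F E i m).toLinearMap LinearMap.id

/-- The pull back `i^* : T*_{i(m)} X → T*_m M`. -/
def pullCot (i : M → X) (m : M) : Cot E (i m) →ₗ[ℝ] Cot F m where
  toFun ξ := ξ.comp (dmap F E i m)
  map_add' ξ η := ContinuousLinearMap.add_comp ξ η (dmap F E i m)
  map_smul' c ξ := ContinuousLinearMap.smul_comp c ξ (dmap F E i m)

/-- The map `p = id ⊕ i^* : TM ⊕ T*X|_M → TM ⊕ T*M`. -/
def pmap (i : M → X) (m : M) : RT F E i m →ₗ[ℝ] GT F m :=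
  LinearMap.prodMap LinearMap.id (pullCot i m)

/-- The conormal space `N*_m = {0 + ξ | ξ vanishes on T_m M}`, as a subspace of
`T_{i(m)} X ⊕ T*_{i(m)} X`. -/
def conormal (F : Type*) [NormedAddCommGroup F] [NormedSpace ℝ F] {M : Type*}
    [TopologicalSpace M] [ChartedSpace F M] (i : M → X) (m : M) : Submodule ℝ (GT E (i m)) :=
  Submodule.prod ⊥ (LinearMap.ker (pullCot (F := F) i m))

/-- The conormal bundle of `M` is `J`-invariant: `J(N*) = N*`. -/
def ConormalInvariant (F : Type*) [NormedAddCommGroup F] [NormedSpace ℝ F] {M : Type*}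
    [TopologicalSpace M] [ChartedSpace F M] (i : M → X) (J : EndField E X) : Prop :=
  ∀ m : M, (conormal F i m).map (J (i m)) = conormal F i m

/-- `L_J(M) = L_J ∩ (TM ⊕ T*X|_M)^ℂ`. -/
def LM (F : Type*) [NormedAddCommGroup F] [NormedSpace ℝ F] {M : Type*}
    [TopologicalSpace M] [ChartedSpace F M] (i : M → X) (J : EndField E X) (m : M) :
    Submodule ℂ (ℂ ⊗[ℝ] RT F E i m) :=
  (eigenL J (i m)).comap ((incl i m).baseChange ℂ)

/-- `L_J(N*) = L_J ∩ (N*)^ℂ`, as a subspace of `(TM ⊕ T*X|_M)^ℂ`. -/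
def LN (F : Type*) [NormedAddCommGroup F] [NormedSpace ℝ F] {M : Type*}
    [TopologicalSpace M] [ChartedSpace F M] (i : M → X) (J : EndField E X) (m : M) :
    Submodule ℂ (ℂ ⊗[ℝ] RT F E i m) :=
  LM F i J m ⊓ ((conormal F i m).comap (incl i m)).baseChange ℂ

/-- A family `S` of complex subspaces of the fibres of `(TM ⊕ T*X|_M)^ℂ` is a smooth subbundle:
locally on `M` it has a frame consisting of smooth sections. -/
def IsSubbundle [IsManifold 𝓘(ℝ, E) ∞ X] [IsManifold 𝓘(ℝ, F) ∞ M] (i : M → X)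
    (S : ∀ m : M, Submodule ℂ (ℂ ⊗[ℝ] RT F E i m)) : Prop :=
  ∀ m₀ : M, ∃ U : Set M, IsOpen U ∧ m₀ ∈ U ∧ ∃ (k : ℕ) (a b : Fin k → ∀ m : M, RT F E i m),
    (∀ j, SmoothVecAlong (F := F) (fun m : M ↦ m) U (fun m ↦ (a j m).1) ∧
      SmoothCovAlong (F := F) i U (fun m ↦ (a j m).2)) ∧
    (∀ j, SmoothVecAlong (F := F) (fun m : M ↦ m) U (fun m ↦ (b j m).1) ∧
      SmoothCovAlong (F := F) i U (fun m ↦ (b j m).2)) ∧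
    ∀ m ∈ U, LinearIndependent ℂ (fun j ↦ cplx (a j m) (b j m)) ∧
      Submodule.span ℂ (Set.range (fun j ↦ cplx (a j m) (b j m))) = S m

/-- `M` is a `J`-submanifold: `L_J(M)` and `L_J(N*)` are subbundles and the sequence
`0 → L_J(N*) ⊕ L̄_J(N*) → L_J(M) ⊕ L̄_J(M) → (TM ⊕ T*M)^ℂ → 0`, whose first map is the inclusion and
whose second map `q` is the restriction of `p`, is exact. (The sums are internal sums in
`(TM ⊕ T*X|_M)^ℂ`; they are direct because `L_J` and `L̄_J` belong to different eigenvalues.) -/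
structure IsJSubmanifold [IsManifold 𝓘(ℝ, E) ∞ X] [IsManifold 𝓘(ℝ, F) ∞ M] (i : M → X)
    (J : EndField E X) : Prop where
  subbundle_LM : IsSubbundle i (LM F i J)
  subbundle_LN : IsSubbundle i (LN F i J)
  exact_middle : ∀ m : M, LN F i J m ⊔ conjSub (LN F i J m) =
    (LM F i J m ⊔ conjSub (LM F i J m)) ⊓ LinearMap.ker ((pmap i m).baseChange ℂ)
  surjective : ∀ m : M,
    (LM F i J m ⊔ conjSub (LM F i J m)).map ((pmap i m).baseChange ℂ) = ⊤

/-- `M` is a generalized Kähler submanifold of `(X, J₀, J₁)`. -/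
def IsGKSubmanifold [IsManifold 𝓘(ℝ, E) ∞ X] [IsManifold 𝓘(ℝ, F) ∞ M]
    (i : M → X) (J₀ J₁ : EndField E X) : Prop :=
  IsJSubmanifold (F := F) i J₀ ∧ IsJSubmanifold (F := F) i J₁

/-- `JM` is the structure on `TM ⊕ T*M` induced by `J` through the quotient map
`q : L_J(M) ⊕ L̄_J(M) → (TM ⊕ T*M)^ℂ`: it is the operator with `JM ∘ q = q ∘ J`, where `J` acts on
`L_J(M)` as `-√-1` and on `L̄_J(M)` as `√-1`. -/
def IsInduced (i : M → X) (J : EndField E X) (JM : EndField F M) : Prop :=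
  ∀ m : M,
    (∀ e ∈ LM F i J m, (JM m).baseChange ℂ ((pmap i m).baseChange ℂ e) =
      (-Complex.I) • (pmap i m).baseChange ℂ e) ∧
    (∀ e ∈ conjSub (LM F i J m), (JM m).baseChange ℂ ((pmap i m).baseChange ℂ e) =
      Complex.I • (pmap i m).baseChange ℂ e)

end Manifold

end GenKahler

end

/-! Write R for TM ⊕ T*X|_M inside TX ⊕ T*X along M. The map p : R → TM ⊕ T*M is surjective with
kernel N*, it preserves the pairings, and R is the orthogonal complement of N*. Also L_J consists of
the vectors a + √-1 J a, so every condition on L_J(M) and L_J(N*) becomes a real condition on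
vectors e in R with J e in R, which form the J-invariant part of R.

For J₀: it is orthogonal and preserves N*, hence preserves R (`exists_incl_of_conormalInvariant`)
and acts on R/N* = TM ⊕ T*M.

For J₁: let H be its invariant part in R. If n lies in H ∩ N*, then ⟨G n, n⟩ = ⟨J₀ G n, J₀ n⟩ = ⟨J₁
n, J₀ n⟩ = 0, because J₁ n is in R and J₀ n in N*; positivity gives n = 0 (`eq_zero_of_conormal`). H
is the kernel of a map from R to a space of dimension dim X - dim M, so dim H ≥ 2 dim M
(`finrank_invariantPart_le`). Hence p restricts to an isomorphism H ≅ TM ⊕ T*M.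

Let σ be the inverse of this isomorphism. It is isometric. J₀ preserves H too, since it preserves R
and commutes with J₁, so σ conjugates both induced structures to restrictions of J₀ and J₁
(`intertwines₀`, `intertwines₁`). The algebraic axioms of a generalized Kähler structure pass
through σ.

There remain two analytic points. The lift σ solves an injective linear system with smooth
coefficients, so it is smooth (`IsLift.exists_smooth`); smooth frames of the eigenbundles come from
constant rank and the openness of linear independence (`isSubbundle_of_spanning`). Involutivity
descends because the Courant bracket respects i-relatedness (`courant_of_related`): lift a section
by σ, extend it to X by a local retraction, complete it to a section of L_J by applying J, and
bracket on X. -/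

noncomputable section

namespace GenKahler

set_option linter.unusedSectionVars false

/-! ## Complexification -/

section Complexification

variable {V W : Type*} [AddCommGroup V] [Module ℝ V] [AddCommGroup W] [Module ℝ W]

/-- The real part of an element of the complexification. -/
def reC (V : Type*) [AddCommGroup V] [Module ℝ V] : ℂ ⊗[ℝ] V →ₗ[ℝ] V :=
  (TensorProduct.lid ℝ V).toLinearMap ∘ₗ LinearMap.rTensor V Complex.reLm

/-- The imaginary part of an element of the complexification. -/
def imC (V : Type*) [AddCommGroup V] [Module ℝ V] : ℂ ⊗[ℝ] V →ₗ[ℝ] V :=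
  (TensorProduct.lid ℝ V).toLinearMap ∘ₗ LinearMap.rTensor V Complex.imLm

lemma reC_tmul (z : ℂ) (v : V) : reC V (z ⊗ₜ v) = z.re • v := by simp [reC]

lemma imC_tmul (z : ℂ) (v : V) : imC V (z ⊗ₜ v) = z.im • v := by simp [imC]

lemma cplx_add (a b c d : V) : cplx a b + cplx c d = cplx (a + c) (b + d) := by
  simp only [cplx, TensorProduct.tmul_add]; abel

lemma cplx_re_im (z : ℂ ⊗[ℝ] V) : cplx (reC V z) (imC V z) = z := by
  induction z using TensorProduct.induction_on with
  | zero => simp [cplx]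
  | tmul z v =>
    rw [reC_tmul, imC_tmul, cplx, ← TensorProduct.smul_tmul, ← TensorProduct.smul_tmul,
      ← TensorProduct.add_tmul]
    congr 1
    simp only [Complex.real_smul, mul_one, Complex.re_add_im]
  | add z w hz hw => rw [map_add, map_add, ← cplx_add, hz, hw]

lemma exists_cplx (z : ℂ ⊗[ℝ] V) : ∃ a b, z = cplx a b := ⟨_, _, (cplx_re_im z).symm⟩

lemma reC_cplx (a b : V) : reC V (cplx a b) = a := by
  simp [cplx, reC_tmul]

lemma imC_cplx (a b : V) : imC V (cplx a b) = b := by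
  simp [cplx, imC_tmul]

lemma cplx_inj {a b c d : V} : cplx a b = cplx c d ↔ a = c ∧ b = d := by
  refine ⟨fun h ↦ ⟨?_, ?_⟩, fun h ↦ by rw [h.1, h.2]⟩
  · simpa only [reC_cplx] using congrArg (reC V) h
  · simpa only [imC_cplx] using congrArg (imC V) h

lemma cplx_zero : cplx (0 : V) 0 = 0 := by simp [cplx]

lemma cplx_eq_zero {a b : V} : cplx a b = 0 ↔ a = 0 ∧ b = 0 := by
  rw [← cplx_zero, cplx_inj]

lemma smul_cplx (z : ℂ) (a b : V) :
    z • cplx a b = cplx (z.re • a - z.im • b) (z.re • b + z.im • a) := by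
  have h (w : ℂ) (v : V) : w ⊗ₜ[ℝ] v = cplx (w.re • v) (w.im • v) := by
    rw [← cplx_re_im (w ⊗ₜ[ℝ] v), reC_tmul, imC_tmul]
  rw [cplx, smul_add, TensorProduct.smul_tmul', TensorProduct.smul_tmul', h, h, cplx_add]
  simp [sub_eq_add_neg, add_comm]

lemma I_smul_cplx (a b : V) : Complex.I • cplx a b = cplx (-b) a := by
  simp [smul_cplx]

lemma neg_I_smul_cplx (a b : V) : (-Complex.I) • cplx a b = cplx b (-a) := by
  rw [smul_cplx]; simp

lemma sum_cplx {ι : Type*} (s : Finset ι) (a b : ι → V) :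
    ∑ j ∈ s, cplx (a j) (b j) = cplx (∑ j ∈ s, a j) (∑ j ∈ s, b j) := by
  simp only [cplx, Finset.sum_add_distrib, TensorProduct.tmul_sum]

lemma baseChange_cplx (f : V →ₗ[ℝ] W) (a b : V) :
    f.baseChange ℂ (cplx a b) = cplx (f a) (f b) := by
  simp [cplx]

lemma conjC_cplx (a b : V) : conjC V (cplx a b) = cplx a (-b) := by
  change TensorProduct.map _ _ (cplx a b) = _
  simp [cplx, TensorProduct.neg_tmul, TensorProduct.tmul_neg]

lemma cplx_mem_conjSub {S : Submodule ℂ (ℂ ⊗[ℝ] V)} {a b : V} :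
    cplx a b ∈ conjSub S ↔ cplx a (-b) ∈ S := by
  constructor
  · rintro ⟨z, hz, h⟩
    obtain ⟨c, d, rfl⟩ := exists_cplx z
    rw [conjC_cplx, cplx_inj] at h
    rwa [← h.1, ← h.2, neg_neg]
  · intro h
    exact ⟨_, h, by rw [conjC_cplx, neg_neg]⟩

lemma cplx_mem_ker_baseChange {f : V →ₗ[ℝ] W} {a b : V} :
    cplx a b ∈ LinearMap.ker (f.baseChange ℂ) ↔ f a = 0 ∧ f b = 0 := by
  rw [LinearMap.mem_ker, baseChange_cplx, cplx_eq_zero]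

lemma cplx_mem_baseChange {S : Submodule ℝ V} {a b : V} :
    cplx a b ∈ S.baseChange ℂ ↔ a ∈ S ∧ b ∈ S := by
  constructor
  · intro h
    have key : ∀ z ∈ S.baseChange ℂ, reC V z ∈ S ∧ imC V z ∈ S := by
      intro z hz
      rw [Submodule.baseChange_eq_span] at hz
      induction hz using Submodule.span_induction with
      | mem x hx =>
        obtain ⟨v, hv, rfl⟩ := hx
        have hv' : v ∈ S := hv
        simp [reC_tmul, imC_tmul, hv']
      | zero => simp
      | add x y _ _ hx hy => simp [S.add_mem, hx, hy]
      | smul z x _ hx =>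
        obtain ⟨c, d, rfl⟩ := exists_cplx x
        rw [smul_cplx, reC_cplx, imC_cplx]
        rw [reC_cplx, imC_cplx] at hx
        exact ⟨S.sub_mem (S.smul_mem _ hx.1) (S.smul_mem _ hx.2),
          S.add_mem (S.smul_mem _ hx.2) (S.smul_mem _ hx.1)⟩
    simpa only [reC_cplx, imC_cplx] using key _ h
  · rintro ⟨ha, hb⟩
    exact add_mem (Submodule.tmul_mem_baseChange_of_mem _ ha)
      (Submodule.tmul_mem_baseChange_of_mem _ hb)

/-- Since -√-1 (a + √-1 b) = b - √-1 a, the eigenvector equation reads J a = b and J b = -a, and J²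
= -1 makes the second redundant. This is the passage from L_J to real vectors used throughout. -/
lemma cplx_mem_eigenspace {J : Module.End ℝ V} (hJ : J * J = -1) {a b : V} :
    cplx a b ∈ Module.End.eigenspace (J.baseChange ℂ) (-Complex.I) ↔ J a = b := by
  rw [Module.End.mem_eigenspace_iff, neg_I_smul_cplx]
  rw [show (LinearMap.baseChange ℂ J) (cplx a b) = _ from baseChange_cplx J a b, cplx_inj]
  refine ⟨And.left, fun h ↦ ⟨h, ?_⟩⟩
  rw [← h, ← Module.End.mul_apply, hJ]
  rfl

end Complexification

/-! ## Complex structures on real vector spaces -/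

section LinearAlgebra

variable {V : Type*} [AddCommGroup V] [Module ℝ V]

lemma apply_apply_of_sq {J : Module.End ℝ V} (hJ : J * J = -1) (v : V) : J (J v) = -v := by
  rw [← Module.End.mul_apply, hJ]; rfl

/-- A complex structure on an even-dimensional real vector space has determinant one. -/
lemma det_eq_one_of_sq [FiniteDimensional ℝ V] {J : Module.End ℝ V} (hJ : J * J = -1)
    (hV : Even (Module.finrank ℝ V)) : LinearMap.det J = 1 := by
  have h1 : LinearMap.det J * LinearMap.det J = 1 := by
    rw [← map_mul, hJ, ← neg_one_smul ℝ (1 : Module.End ℝ V), LinearMap.det_smul, hV.neg_one_pow]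
    simp
  -- (1 + J)² = 2 J exhibits a positive multiple of det J as a square, which excludes det J = -1.
  have h2 : LinearMap.det (1 + J) * LinearMap.det (1 + J) =
      2 ^ Module.finrank ℝ V * LinearMap.det J := by
    rw [← map_mul, ← LinearMap.det_smul]
    congr 1
    rw [add_mul, mul_add, mul_add, hJ, two_smul, mul_one, one_mul, mul_one]
    abel
  have h3 : 0 ≤ LinearMap.det J := by
    have : 0 ≤ (2 : ℝ) ^ Module.finrank ℝ V * LinearMap.det J := h2 ▸ mul_self_nonneg _
    exact nonneg_of_mul_nonneg_right this (by positivity)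
  nlinarith

/-- Complex independence of the vectors `x + √-1 J x` is real independence of the `x`, `J x`. -/
lemma linearIndependent_cplx {k : ℕ} {x y : Fin k → V}
    (h : LinearIndependent ℝ (Sum.elim x y)) :
    LinearIndependent ℂ (fun j ↦ cplx (x j) (y j)) := by
  rw [Fintype.linearIndependent_iff] at h ⊢
  intro g hg j
  simp only [smul_cplx, sum_cplx, cplx_eq_zero] at hg
  -- The real part of (p + √-1 q)(x + √-1 y) is p x - q y, whence the sign on the imaginary
  -- coefficients.
  have := h (Sum.elim (fun j ↦ (g j).re) (fun j ↦ -(g j).im)) (by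
    rw [Fintype.sum_sum_type, ← Finset.sum_add_distrib]
    simpa [sub_eq_add_neg] using hg.1)
  refine Complex.ext ?_ ?_
  · simpa using this (Sum.inl j)
  · simpa using this (Sum.inr j)

/-- A real relation among the x and y = J x is the real part of a complex relation among the x + √-1
y; applying J to it supplies the imaginary part. -/
lemma linearIndependent_sum_of_cplx {J : Module.End ℝ V} (hJ : J * J = -1) {k : ℕ}
    {x y : Fin k → V} (hxy : ∀ j, J (x j) = y j)
    (h : LinearIndependent ℂ (fun j ↦ cplx (x j) (y j))) :
    LinearIndependent ℝ (Sum.elim x y) := by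
  rw [Fintype.linearIndependent_iff] at h ⊢
  intro g hg
  rw [Fintype.sum_sum_type, ← Finset.sum_add_distrib] at hg
  simp only [Sum.elim_inl, Sum.elim_inr] at hg
  have hyx (j) : J (y j) = -x j := by rw [← hxy, apply_apply_of_sq hJ]
  have hg' := congrArg J hg
  simp only [map_sum, map_add, map_smul, hxy, hyx, map_zero] at hg'
  have := h (fun j ↦ ⟨g (Sum.inl j), -g (Sum.inr j)⟩) (by
    simp only [smul_cplx, sum_cplx, cplx_eq_zero]
    refine ⟨by simpa [sub_eq_add_neg] using hg, by simpa [sub_eq_add_neg] using hg'⟩)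
  rintro (j | j)
  · simpa using congrArg Complex.re (this j)
  · simpa using congrArg Complex.im (this j)

/-- If `x` and `y = J x` span `S`, then the `x + √-1 y` span the `(-√-1)`-eigenspace of `J` in
`S^ℂ`. -/
lemma exists_cplx_mem_span {W : Type*} [AddCommGroup W] [Module ℝ W] {J : Module.End ℝ W}
    (hJ : J * J = -1) {f : V →ₗ[ℝ] W} {k : ℕ} {x y : Fin k → V} (hxy : ∀ j, J (f (x j)) = f (y j))
    {e : V} (he : e ∈ Submodule.span ℝ (Set.range (Sum.elim x y))) :
    ∃ e', J (f e) = f e' ∧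
      cplx e e' ∈ Submodule.span ℂ (Set.range (fun j ↦ cplx (x j) (y j))) := by
  have hyx (j) : J (f (y j)) = f (-x j) := by rw [← hxy, apply_apply_of_sq hJ, map_neg]
  induction he using Submodule.span_induction with
  | mem e he =>
    obtain ⟨j | j, rfl⟩ := he
    · exact ⟨y j, hxy j, Submodule.subset_span ⟨j, rfl⟩⟩
    · refine ⟨-x j, hyx j, ?_⟩
      rw [Sum.elim_inr, ← neg_I_smul_cplx]
      exact Submodule.smul_mem _ _ (Submodule.subset_span ⟨j, rfl⟩)
  | zero => exact ⟨0, by simp, by simp [cplx_zero]⟩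
  | add e₁ e₂ _ _ h₁ h₂ =>
    obtain ⟨e₁', h₁, h₁'⟩ := h₁
    obtain ⟨e₂', h₂, h₂'⟩ := h₂
    exact ⟨e₁' + e₂', by simp [h₁, h₂], by rw [← cplx_add]; exact add_mem h₁' h₂'⟩
  | smul t e _ h =>
    obtain ⟨e', h, h'⟩ := h
    refine ⟨t • e', by simp [h], ?_⟩
    have : cplx (t • e) (t • e') = (t : ℂ) • cplx e e' := by
      rw [smul_cplx]; simp
    rw [this]; exact Submodule.smul_mem _ _ h'

/-- A spanning family of a complex subspace contains a real basis of the form `x`, `J x`. -/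
lemma exists_complex_frame [FiniteDimensional ℝ V] {J : Module.End ℝ V} (hJ : J * J = -1)
    {A : Type*} [AddCommGroup A] [Module ℝ A] (B : A →ₗ[ℝ] V)
    (hB : ∀ α, J (B α) ∈ LinearMap.range B) :
    ∃ (k : ℕ) (α : Fin k → A),
      LinearIndependent ℝ (Sum.elim (fun j ↦ B (α j)) (fun j ↦ J (B (α j)))) ∧
      2 * k = Module.finrank ℝ (LinearMap.range B) := by
  -- A complex basis is extracted from the vectors B α + √-1 J B α; its real and imaginary parts
  -- then form a real basis of the range of B.
  obtain ⟨b, hbt, hspan, hli⟩ :=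
    exists_linearIndependent ℂ (Set.range fun α ↦ cplx (B α) (J (B α)))
  have hfin : Finite b := hli.finite
  have := Fintype.ofFinite b
  let eqv := Fintype.equivFin b
  choose α hα using fun j : Fin (Fintype.card b) ↦ hbt (eqv.symm j).2
  have hli' : LinearIndependent ℂ (fun j ↦ cplx (B (α j)) (J (B (α j)))) := by
    have := hli.comp _ eqv.symm.injective
    rwa [show Subtype.val ∘ eqv.symm = fun j ↦ cplx (B (α j)) (J (B (α j))) from
      funext fun j ↦ (hα j).symm] at this
  have hR := linearIndependent_sum_of_cplx hJ (fun _ ↦ rfl) hli'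
  refine ⟨_, α, hR, ?_⟩
  have hspan' : Submodule.span ℝ (Set.range
      (Sum.elim (fun j ↦ B (α j)) (fun j ↦ J (B (α j))))) = LinearMap.range B := by
    refine le_antisymm (Submodule.span_le.2 ?_) ?_
    · rintro _ ⟨j | j, rfl⟩
      · exact ⟨α j, rfl⟩
      · exact hB _
    · rintro _ ⟨β, rfl⟩
      have hβ : cplx (B β) (J (B β)) ∈ Submodule.span ℂ b := by
        rw [hspan]; exact Submodule.subset_span ⟨β, rfl⟩
      have key : ∀ z ∈ Submodule.span ℂ b, reC V z ∈ Submodule.span ℝ (Set.range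
          (Sum.elim (fun j ↦ B (α j)) (fun j ↦ J (B (α j))))) ∧
          imC V z ∈ Submodule.span ℝ (Set.range
          (Sum.elim (fun j ↦ B (α j)) (fun j ↦ J (B (α j))))) := by
        intro z hz
        induction hz using Submodule.span_induction with
        | mem z hz =>
          have h := hα (eqv ⟨z, hz⟩)
          simp only [Equiv.symm_apply_apply] at h
          rw [← h, reC_cplx, imC_cplx]
          exact ⟨Submodule.subset_span ⟨Sum.inl _, rfl⟩, Submodule.subset_span ⟨Sum.inr _, rfl⟩⟩
        | zero => simp
        | add z w _ _ hz hw =>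
          rw [map_add, map_add]; exact ⟨add_mem hz.1 hw.1, add_mem hz.2 hw.2⟩
        | smul c z _ hz =>
          obtain ⟨a, d, rfl⟩ := exists_cplx z
          rw [smul_cplx, reC_cplx, imC_cplx]
          rw [reC_cplx, imC_cplx] at hz
          exact ⟨sub_mem (Submodule.smul_mem _ _ hz.1) (Submodule.smul_mem _ _ hz.2),
            add_mem (Submodule.smul_mem _ _ hz.2) (Submodule.smul_mem _ _ hz.1)⟩
      simpa only [reC_cplx] using (key _ hβ).1
  rw [← hspan', finrank_span_eq_card hR, Fintype.card_sum, Fintype.card_fin]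
  ring

end LinearAlgebra

/-! ## Local coordinates -/

section Coordinates

variable {E : Type*} [NormedAddCommGroup E] [NormedSpace ℝ E]
  {X : Type*} [TopologicalSpace X] [ChartedSpace E X]

/-- The coordinates of a tangent vector at `x` in the chart at `x₀`. -/
def tanCoord (x₀ x : X) : Tan E x →L[ℝ] E :=
  mfderiv 𝓘(ℝ, E) 𝓘(ℝ, E) (extChartAt 𝓘(ℝ, E) x₀) x

/-- The tangent vector at `x` with given coordinates in the chart at `x₀`. -/
def tanFrame (x₀ x : X) : E →L[ℝ] Tan E x :=
  mfderiv 𝓘(ℝ, E) 𝓘(ℝ, E) (extChartAt 𝓘(ℝ, E) x₀).symm (extChartAt 𝓘(ℝ, E) x₀ x)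

/-- The coordinates of a cotangent vector at `x` in the chart at `x₀`. -/
def cotCoord (x₀ x : X) : Cot E x →ₗ[ℝ] (E →L[ℝ] ℝ) where
  toFun ξ := ξ.comp (tanFrame x₀ x)
  map_add' ξ η := ContinuousLinearMap.add_comp ξ η (tanFrame x₀ x)
  map_smul' c ξ := ContinuousLinearMap.smul_comp c ξ (tanFrame x₀ x)

/-- The cotangent vector at `x` with given coordinates in the chart at `x₀`. -/
def cotFrame (x₀ x : X) : (E →L[ℝ] ℝ) →ₗ[ℝ] Cot E x where
  toFun ξ := ξ.comp (tanCoord x₀ x)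
  map_add' ξ η := ContinuousLinearMap.add_comp ξ η (tanCoord x₀ x)
  map_smul' c ξ := ContinuousLinearMap.smul_comp c ξ (tanCoord x₀ x)

@[simp] lemma cotCoord_apply (x₀ x : X) (ξ : Cot E x) (e : E) :
    cotCoord x₀ x ξ e = ξ (tanFrame x₀ x e) := rfl

@[simp] lemma cotFrame_apply (x₀ x : X) (ξ : E →L[ℝ] ℝ) (v : Tan E x) :
    cotFrame x₀ x ξ v = ξ (tanCoord x₀ x v) := rfl

variable [IsManifold 𝓘(ℝ, E) ∞ X] {x₀ x : X}

lemma continuousLinearMapAt_eq_tanCoord (hx : x ∈ (chartAt E x₀).source) :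
    (trivializationAt E (TangentSpace 𝓘(ℝ, E)) x₀).continuousLinearMapAt ℝ x =
      (tanCoord x₀ x : TangentSpace 𝓘(ℝ, E) x →L[ℝ] E) :=
  TangentBundle.continuousLinearMapAt_trivializationAt hx

lemma symmL_eq_tanFrame (hx : x ∈ (chartAt E x₀).source) :
    (trivializationAt E (TangentSpace 𝓘(ℝ, E)) x₀).symmL ℝ x =
      (tanFrame x₀ x : E →L[ℝ] TangentSpace 𝓘(ℝ, E) x) := by
  refine (TangentBundle.symmL_trivializationAt hx).trans ?_
  simp only [modelWithCornersSelf_coe, Set.range_id, mfderivWithin_univ]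
  rfl

lemma tanCoord_tanFrame (hx : x ∈ (chartAt E x₀).source) (e : E) :
    tanCoord x₀ x (tanFrame x₀ x e) = e := by
  rw [← continuousLinearMapAt_eq_tanCoord hx, ← symmL_eq_tanFrame hx]
  exact Trivialization.continuousLinearMapAt_symmL _ hx e

lemma tanFrame_tanCoord (hx : x ∈ (chartAt E x₀).source) (v : Tan E x) :
    tanFrame x₀ x (tanCoord x₀ x v) = v := by
  rw [← continuousLinearMapAt_eq_tanCoord hx, ← symmL_eq_tanFrame hx]
  exact Trivialization.symmL_continuousLinearMapAt _ hx v

lemma cotCoord_cotFrame (hx : x ∈ (chartAt E x₀).source) (ξ : E →L[ℝ] ℝ) :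
    cotCoord x₀ x (cotFrame x₀ x ξ) = ξ := by
  ext e; simp [tanCoord_tanFrame hx]

lemma cotFrame_cotCoord (hx : x ∈ (chartAt E x₀).source) (ξ : Cot E x) :
    cotFrame x₀ x (cotCoord x₀ x ξ) = ξ := by
  refine ContinuousLinearMap.ext fun v ↦ ?_
  simp [tanFrame_tanCoord hx]

variable {F Y : Type*} [NormedAddCommGroup F] [NormedSpace ℝ F] [TopologicalSpace Y]
  [ChartedSpace F Y] {i : Y → X} {U : Set Y}

/-- In one fixed chart the tangent trivialization is the derivative of the chart, so smoothness of a
section becomes smoothness of a map into a fixed vector space. -/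
lemma smoothVecAlong_iff_coord (hi : ContMDiffOn 𝓘(ℝ, F) 𝓘(ℝ, E) ∞ i U)
    (hU : ∀ y ∈ U, i y ∈ (chartAt E x₀).source) (v : ∀ y, Tan E (i y)) :
    SmoothVecAlong (F := F) i U v ↔
      ContMDiffOn 𝓘(ℝ, F) 𝓘(ℝ, E) ∞ (fun y ↦ tanCoord x₀ (i y) (v y)) U := by
  unfold SmoothVecAlong
  rw [Trivialization.contMDiffOn_iff
    (e := trivializationAt E (fun x : X ↦ TangentSpace 𝓘(ℝ, E) x) x₀)]
  · refine (and_iff_right hi).trans (contMDiffOn_congr fun y hy ↦ ?_)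
    rw [← continuousLinearMapAt_eq_tanCoord (hU y hy)]
    exact (Trivialization.continuousLinearMapAt_apply_of_mem ℝ _ (hU y hy) _).symm
  · intro y hy
    exact (Trivialization.mem_source _).2 (hU y hy)

lemma smoothCovAlong_iff_coord (hi : ContMDiffOn 𝓘(ℝ, F) 𝓘(ℝ, E) ∞ i U)
    (hU : ∀ y ∈ U, i y ∈ (chartAt E x₀).source) (ξ : ∀ y, Cot E (i y)) :
    SmoothCovAlong (F := F) i U ξ ↔
      ContMDiffOn 𝓘(ℝ, F) 𝓘(ℝ, E →L[ℝ] ℝ) ∞ (fun y ↦ cotCoord x₀ (i y) (ξ y)) U := by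
  unfold SmoothCovAlong
  rw [Trivialization.contMDiffOn_iff
    (e := trivializationAt (E →L[ℝ] ℝ)
      (fun x : X ↦ TangentSpace 𝓘(ℝ, E) x →L[ℝ] Trivial X ℝ x) x₀)]
  · refine (and_iff_right hi).trans (contMDiffOn_congr fun y hy ↦ ?_)
    rw [hom_trivializationAt_apply]
    ext e
    simp only [ContinuousLinearMap.inCoordinates, cotCoord_apply, ContinuousLinearMap.comp_apply,
      symmL_eq_tanFrame (hU y hy)]
    simp
  · intro y hy
    refine (Trivialization.mem_source _).2 ?_
    rw [hom_trivializationAt_baseSet]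
    exact ⟨hU y hy, Set.mem_univ _⟩

end Coordinates

/-! ## Smooth families of linear maps -/

section Families

variable {F Y : Type*} [NormedAddCommGroup F] [NormedSpace ℝ F] [TopologicalSpace Y]
  [ChartedSpace F Y] {A B : Type*} [NormedAddCommGroup A] [NormedSpace ℝ A]
  [NormedAddCommGroup B] [NormedSpace ℝ B] {U : Set Y}

/-- An operator on a finite-dimensional space is a finite sum of rank-one operators built from its
values on a basis, so smoothness can be tested on vectors. -/
lemma contMDiffOn_clm_of_apply [FiniteDimensional ℝ A] {f : Y → A →L[ℝ] B}
    (hf : ∀ a, ContMDiffOn 𝓘(ℝ, F) 𝓘(ℝ, B) ∞ (fun y ↦ f y a) U) :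
    ContMDiffOn 𝓘(ℝ, F) 𝓘(ℝ, A →L[ℝ] B) ∞ f U := by
  let b := Module.finBasis ℝ A
  let c (j) : A →L[ℝ] ℝ := LinearMap.toContinuousLinearMap (b.coord j)
  have h : f = fun y ↦ ∑ j, (ContinuousLinearMap.smulRightL ℝ A B (c j)) (f y (b j)) := by
    funext y
    ext a
    conv_lhs => rw [← b.sum_repr a, map_sum]
    simp [c]
  rw [h]
  refine contMDiffOn_finsetSum fun j _ ↦ ?_
  exact (ContinuousLinearMap.contMDiff _).comp_contMDiffOn (hf (b j))

/-- A smooth family of injective linear maps has a smooth family of left inverses, locally. -/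
lemma exists_smooth_leftInverse [FiniteDimensional ℝ A] [FiniteDimensional ℝ B]
    {Φ : Y → A →L[ℝ] B} (hU : IsOpen U)
    (hΦ : ContMDiffOn 𝓘(ℝ, F) 𝓘(ℝ, A →L[ℝ] B) ∞ Φ U) {y₀ : Y} (hy₀ : y₀ ∈ U)
    (hinj : Function.Injective (Φ y₀)) :
    ∃ V ⊆ U, IsOpen V ∧ y₀ ∈ V ∧ ∃ Ψ : Y → B →L[ℝ] A,
      ContMDiffOn 𝓘(ℝ, F) 𝓘(ℝ, B →L[ℝ] A) ∞ Ψ V ∧ ∀ y ∈ V, ∀ a, Ψ y (Φ y a) = a := by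
  have : CompleteSpace A := FiniteDimensional.complete ℝ A
  -- With Λ a fixed left inverse of Φ y₀, the endomorphism Λ Φ y is the identity at y₀ and
  -- invertible nearby, so (Λ Φ y)⁻¹ Λ is a left inverse, smooth in y.
  obtain ⟨g, hg⟩ := (Φ y₀).toLinearMap.exists_leftInverse_of_injective (LinearMap.ker_eq_bot.2 hinj)
  let Λ : B →L[ℝ] A := LinearMap.toContinuousLinearMap g
  let T : Y → A →L[ℝ] A := fun y ↦ Λ ∘L Φ y
  have hT : ContMDiffOn 𝓘(ℝ, F) 𝓘(ℝ, A →L[ℝ] A) ∞ T U := contMDiffOn_const.clm_comp hΦ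
  have hT₀ : T y₀ = (ContinuousLinearEquiv.refl ℝ A : A →L[ℝ] A) := by
    ext a; exact LinearMap.congr_fun hg a
  let S : Set (A →L[ℝ] A) := Set.range ((↑) : (A ≃L[ℝ] A) → A →L[ℝ] A)
  have hS : IsOpen S := ContinuousLinearEquiv.isOpen
  refine ⟨U ∩ T ⁻¹' S, Set.inter_subset_left, hT.continuousOn.isOpen_inter_preimage hU hS,
    ⟨hy₀, ⟨_, hT₀.symm⟩⟩, fun y ↦ (T y).inverse ∘L Λ, ?_, ?_⟩
  · refine ContMDiffOn.clm_comp (fun y hy ↦ ?_) contMDiffOn_const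
    obtain ⟨e, he⟩ := hy.2
    have h1 := contDiffAt_map_inverse (n := ∞) e
    rw [he] at h1
    exact h1.contMDiffAt.comp_contMDiffWithinAt y ((hT y hy.1).mono Set.inter_subset_left)
  · rintro y ⟨-, e, he⟩ a
    change (T y).inverse (T y a) = a
    rw [← he, ContinuousLinearMap.inverse_equiv]
    simp

end Families

/-! ### Coordinates on TX ⊕ T*X and TM ⊕ T*X|_M. -/

section Coordinates

variable {E : Type*} [NormedAddCommGroup E] [NormedSpace ℝ E]
  {X : Type*} [TopologicalSpace X] [ChartedSpace E X]

/-- The coordinates of an element of `T_x X ⊕ T*_x X` in the chart at `x₀`. -/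
def gtCoord (x₀ x : X) : GT E x →ₗ[ℝ] E × (E →L[ℝ] ℝ) :=
  LinearMap.prodMap (tanCoord x₀ x).toLinearMap (cotCoord x₀ x)

/-- The element of `T_x X ⊕ T*_x X` with given coordinates in the chart at `x₀`. -/
def gtFrame (x₀ x : X) : E × (E →L[ℝ] ℝ) →ₗ[ℝ] GT E x :=
  LinearMap.prodMap (tanFrame x₀ x).toLinearMap (cotFrame x₀ x)

lemma gtCoord_apply (x₀ x : X) (e : GT E x) :
    gtCoord x₀ x e = (tanCoord x₀ x e.1, cotCoord x₀ x e.2) := rfl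

lemma gtFrame_apply (x₀ x : X) (e : E × (E →L[ℝ] ℝ)) :
    gtFrame x₀ x e = (tanFrame x₀ x e.1, cotFrame x₀ x e.2) := rfl

/-- A field of endomorphisms of `TX ⊕ T*X` in the chart at `x₀`. -/
def endCoord [FiniteDimensional ℝ E] (J : EndField E X) (x₀ x : X) :
    (E × (E →L[ℝ] ℝ)) →L[ℝ] (E × (E →L[ℝ] ℝ)) :=
  LinearMap.toContinuousLinearMap (gtCoord x₀ x ∘ₗ J x ∘ₗ gtFrame x₀ x)

variable [IsManifold 𝓘(ℝ, E) ∞ X] {x₀ x : X}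

lemma gtCoord_gtFrame (hx : x ∈ (chartAt E x₀).source) (e : E × (E →L[ℝ] ℝ)) :
    gtCoord x₀ x (gtFrame x₀ x e) = e := by
  rw [gtCoord_apply, gtFrame_apply, tanCoord_tanFrame hx, cotCoord_cotFrame hx]

lemma gtFrame_gtCoord (hx : x ∈ (chartAt E x₀).source) (e : GT E x) :
    gtFrame x₀ x (gtCoord x₀ x e) = e := by
  rw [gtCoord_apply, gtFrame_apply, tanFrame_tanCoord hx, cotFrame_cotCoord hx]

lemma endCoord_gtCoord [FiniteDimensional ℝ E] (J : EndField E X)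
    (hx : x ∈ (chartAt E x₀).source) (e : GT E x) :
    endCoord J x₀ x (gtCoord x₀ x e) = gtCoord x₀ x (J x e) := by
  change gtCoord x₀ x (J x (gtFrame x₀ x (gtCoord x₀ x e))) = _
  rw [gtFrame_gtCoord hx]

lemma smoothGT_iff_coord {U : Set X} (hU : U ⊆ (chartAt E x₀).source) (s : ∀ x, GT E x) :
    SmoothGT U s ↔ ContMDiffOn 𝓘(ℝ, E) 𝓘(ℝ, E × (E →L[ℝ] ℝ)) ∞
      (fun x ↦ gtCoord x₀ x (s x)) U := by
  unfold SmoothGT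
  rw [smoothVecAlong_iff_coord (i := fun x : X ↦ x) contMDiffOn_id hU,
    smoothCovAlong_iff_coord (i := fun x : X ↦ x) contMDiffOn_id hU,
    contMDiffOn_prod_module_iff]
  rfl

lemma SmoothGT.mono {U V : Set X} {s : ∀ x, GT E x} (hs : SmoothGT U s) (h : V ⊆ U) :
    SmoothGT V s := ⟨ContMDiffOn.mono hs.1 h, ContMDiffOn.mono hs.2 h⟩

lemma smoothGT_of_locally {U : Set X} {s : ∀ x, GT E x}
    (h : ∀ x ∈ U, ∃ V, IsOpen V ∧ x ∈ V ∧ SmoothGT (U ∩ V) s) : SmoothGT U s := by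
  constructor
  · refine contMDiffOn_of_locally_contMDiffOn fun x hx ↦ ?_
    obtain ⟨V, h1, h2, h3⟩ := h x hx
    exact ⟨V, h1, h2, h3.1⟩
  · refine contMDiffOn_of_locally_contMDiffOn fun x hx ↦ ?_
    obtain ⟨V, h1, h2, h3⟩ := h x hx
    exact ⟨V, h1, h2, h3.2⟩

/-- The smoothness condition on sections is tested on the frame sections of a chart, whose images
are the columns of the matrix of J. -/
lemma contMDiffOn_endCoord [FiniteDimensional ℝ E] {J : EndField E X}
    (hJ : ∀ U : Set X, IsOpen U → ∀ s : ∀ x : X, GT E x,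
      SmoothGT U s → SmoothGT U (fun x ↦ J x (s x))) (x₀ : X) :
    ContMDiffOn 𝓘(ℝ, E) 𝓘(ℝ, (E × (E →L[ℝ] ℝ)) →L[ℝ] (E × (E →L[ℝ] ℝ))) ∞
      (endCoord J x₀) (chartAt E x₀).source := by
  refine contMDiffOn_clm_of_apply fun a ↦ ?_
  refine (smoothGT_iff_coord subset_rfl _).1
    (hJ _ (chartAt E x₀).open_source (fun x ↦ gtFrame x₀ x a) ?_)
  rw [smoothGT_iff_coord subset_rfl]
  exact (contMDiffOn_const (c := a)).congr fun x hx ↦ gtCoord_gtFrame hx a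

/-! ### Coordinates along a map -/

variable {F : Type*} [NormedAddCommGroup F] [NormedSpace ℝ F]
  {M : Type*} [TopologicalSpace M] [ChartedSpace F M]

/-- The expression of `i` in the charts at `m₀` and `i m₀`. -/
def localRep (F E : Type*) [NormedAddCommGroup F] [NormedSpace ℝ F] [NormedAddCommGroup E]
    [NormedSpace ℝ E] {M X : Type*} [TopologicalSpace M] [ChartedSpace F M] [TopologicalSpace X]
    [ChartedSpace E X] (i : M → X) (m₀ : M) (y : F) : E :=
  extChartAt 𝓘(ℝ, E) (i m₀) (i ((extChartAt 𝓘(ℝ, F) m₀).symm y))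

/-- The points of `M` in the domain of the chart at `m₀` and mapped by `i` to the domain of the
chart at `i m₀`. -/
def chartDom (F E : Type*) [NormedAddCommGroup F] [NormedSpace ℝ F] [NormedAddCommGroup E]
    [NormedSpace ℝ E] {M X : Type*} [TopologicalSpace M] [ChartedSpace F M] [TopologicalSpace X]
    [ChartedSpace E X] (i : M → X) (m₀ : M) : Set M :=
  (chartAt F m₀).source ∩ i ⁻¹' (chartAt E (i m₀)).source

/-- The differential of `i` in the charts at `m₀` and `i m₀`. -/
def dCoord (F E : Type*) [NormedAddCommGroup F] [NormedSpace ℝ F] [NormedAddCommGroup E]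
    [NormedSpace ℝ E] {M X : Type*} [TopologicalSpace M] [ChartedSpace F M] [TopologicalSpace X]
    [ChartedSpace E X] (i : M → X) (m₀ m : M) : F →L[ℝ] E :=
  (tanCoord (i m₀) (i m)).comp ((dmap F E i m).comp (tanFrame m₀ m))

variable {i : M → X} {m₀ m : M}

lemma isOpen_chartDom (hi : Continuous i) (m₀ : M) : IsOpen (chartDom F E i m₀) :=
  (chartAt F m₀).open_source.inter ((chartAt E (i m₀)).open_source.preimage hi)

lemma mem_chartDom (i : M → X) (m₀ : M) : m₀ ∈ chartDom F E i m₀ :=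
  ⟨mem_chart_source F m₀, mem_chart_source E (i m₀)⟩

variable [IsManifold 𝓘(ℝ, F) ∞ M]

lemma dCoord_eq_fderiv (hi : ContMDiff 𝓘(ℝ, F) 𝓘(ℝ, E) ∞ i) (hm : m ∈ chartDom F E i m₀) :
    dCoord F E i m₀ m = fderiv ℝ (localRep F E i m₀) (extChartAt 𝓘(ℝ, F) m₀ m) := by
  rw [← mfderiv_eq_fderiv]
  have hms : m ∈ (extChartAt 𝓘(ℝ, F) m₀).source := by rw [extChartAt_source]; exact hm.1
  have hφm : (extChartAt 𝓘(ℝ, F) m₀).symm (extChartAt 𝓘(ℝ, F) m₀ m) = m :=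
    (extChartAt 𝓘(ℝ, F) m₀).left_inv hms
  have h1 : MDifferentiableAt 𝓘(ℝ, F) 𝓘(ℝ, F) (extChartAt 𝓘(ℝ, F) m₀).symm
      (extChartAt 𝓘(ℝ, F) m₀ m) := by
    have := mdifferentiableWithinAt_extChartAt_symm ((extChartAt 𝓘(ℝ, F) m₀).map_source hms)
    simpa [mdifferentiableWithinAt_univ] using this
  have h2 : MDifferentiableAt 𝓘(ℝ, F) 𝓘(ℝ, E) i
      ((extChartAt 𝓘(ℝ, F) m₀).symm (extChartAt 𝓘(ℝ, F) m₀ m)) :=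
    hi.mdifferentiable (by simp) _
  have h3 : MDifferentiableAt 𝓘(ℝ, E) 𝓘(ℝ, E) (extChartAt 𝓘(ℝ, E) (i m₀))
      (i ((extChartAt 𝓘(ℝ, F) m₀).symm (extChartAt 𝓘(ℝ, F) m₀ m))) := by
    rw [hφm]; exact mdifferentiableAt_extChartAt hm.2
  have h4 := (h3.hasMFDerivAt.comp (extChartAt 𝓘(ℝ, F) m₀ m)
    (h2.hasMFDerivAt.comp (extChartAt 𝓘(ℝ, F) m₀ m) h1.hasMFDerivAt)).mfderiv
  refine Eq.trans ?_ h4.symm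
  unfold dCoord tanCoord dmap tanFrame
  rw [hφm]
  rfl

lemma contDiffOn_localRep (hi : ContMDiff 𝓘(ℝ, F) 𝓘(ℝ, E) ∞ i) (m₀ : M) :
    ContDiffOn ℝ ∞ (localRep F E i m₀)
      ((extChartAt 𝓘(ℝ, F) m₀).target ∩
        (extChartAt 𝓘(ℝ, F) m₀).symm ⁻¹' (chartDom F E i m₀)) := by
  rw [← contMDiffOn_iff_contDiffOn]
  refine (contMDiffOn_extChartAt (x := i m₀)).comp
    (hi.comp_contMDiffOn ((contMDiffOn_extChartAt_symm m₀).mono Set.inter_subset_left)) ?_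
  intro y hy
  exact hy.2.2

lemma isOpen_chartDom_coord (hi : Continuous i) (m₀ : M) :
    IsOpen ((extChartAt 𝓘(ℝ, F) m₀).target ∩
        (extChartAt 𝓘(ℝ, F) m₀).symm ⁻¹' (chartDom F E i m₀)) :=
  (continuousOn_extChartAt_symm m₀).isOpen_inter_preimage (isOpen_extChartAt_target m₀)
    (isOpen_chartDom hi m₀)

lemma mapsTo_chartDom_coord (hm : m ∈ chartDom F E i m₀) :
    extChartAt 𝓘(ℝ, F) m₀ m ∈ (extChartAt 𝓘(ℝ, F) m₀).target ∩
        (extChartAt 𝓘(ℝ, F) m₀).symm ⁻¹' (chartDom F E i m₀) := by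
  have hms : m ∈ (extChartAt 𝓘(ℝ, F) m₀).source := by rw [extChartAt_source]; exact hm.1
  refine ⟨(extChartAt 𝓘(ℝ, F) m₀).map_source hms, ?_⟩
  rwa [Set.mem_preimage, (extChartAt 𝓘(ℝ, F) m₀).left_inv hms]

/-- In charts the differential is the Fréchet derivative of the smooth map `localRep`. -/
lemma contMDiffOn_dCoord (hi : ContMDiff 𝓘(ℝ, F) 𝓘(ℝ, E) ∞ i) (m₀ : M) :
    ContMDiffOn 𝓘(ℝ, F) 𝓘(ℝ, F →L[ℝ] E) ∞ (dCoord F E i m₀) (chartDom F E i m₀) := by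
  have h := (contDiffOn_localRep hi m₀).fderiv_of_isOpen (m := ∞)
    (isOpen_chartDom_coord hi.continuous m₀) (by simp)
  rw [← contMDiffOn_iff_contDiffOn] at h
  refine (h.comp ((contMDiffOn_extChartAt (x := m₀)).mono Set.inter_subset_left)
    fun m hm ↦ mapsTo_chartDom_coord hm).congr fun m hm ↦ ?_
  exact dCoord_eq_fderiv hi hm

lemma tanCoord_dmap (hm : m ∈ chartDom F E i m₀) (u : Tan F m) :
    tanCoord (i m₀) (i m) (dmap F E i m u) = dCoord F E i m₀ m (tanCoord m₀ m u) := by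
  simp [dCoord, tanFrame_tanCoord hm.1]

lemma cotCoord_pullCot (hm : m ∈ chartDom F E i m₀) (ξ : Cot E (i m)) :
    cotCoord m₀ m (pullCot i m ξ) = (cotCoord (i m₀) (i m) ξ).comp (dCoord F E i m₀ m) := by
  ext u
  change ξ (dmap F E i m (tanFrame m₀ m u)) = ξ (tanFrame (i m₀) (i m) (dCoord F E i m₀ m u))
  simp [dCoord, tanFrame_tanCoord hm.2]

/-- The coordinates of an element of `TM ⊕ T*X|_M`. -/
def rtCoord (i : M → X) (m₀ m : M) : RT F E i m →ₗ[ℝ] F × (E →L[ℝ] ℝ) :=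
  LinearMap.prodMap (tanCoord m₀ m).toLinearMap (cotCoord (i m₀) (i m))

/-- The element of `TM ⊕ T*X|_M` with given coordinates. -/
def rtFrame (i : M → X) (m₀ m : M) : F × (E →L[ℝ] ℝ) →ₗ[ℝ] RT F E i m :=
  LinearMap.prodMap (tanFrame m₀ m).toLinearMap (cotFrame (i m₀) (i m))

lemma rtCoord_apply (e : RT F E i m) :
    rtCoord i m₀ m e = (tanCoord m₀ m e.1, cotCoord (i m₀) (i m) e.2) := rfl

lemma rtFrame_apply (e : F × (E →L[ℝ] ℝ)) :
    rtFrame i m₀ m e = (tanFrame m₀ m e.1, cotFrame (i m₀) (i m) e.2) := rfl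

lemma rtCoord_rtFrame (hm : m ∈ chartDom F E i m₀) (e : F × (E →L[ℝ] ℝ)) :
    rtCoord i m₀ m (rtFrame i m₀ m e) = e := by
  rw [rtCoord_apply, rtFrame_apply, tanCoord_tanFrame hm.1, cotCoord_cotFrame hm.2]

lemma rtFrame_rtCoord (hm : m ∈ chartDom F E i m₀) (e : RT F E i m) :
    rtFrame i m₀ m (rtCoord i m₀ m e) = e := by
  rw [rtCoord_apply, rtFrame_apply, tanFrame_tanCoord hm.1, cotFrame_cotCoord hm.2]

/-- A smooth section of `TM ⊕ T*X|_M` over `U`. -/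
def SmoothRT (i : M → X) (U : Set M) (s : ∀ m, RT F E i m) : Prop :=
  SmoothVecAlong (F := F) (fun m : M ↦ m) U (fun m ↦ (s m).1) ∧
    SmoothCovAlong (F := F) i U (fun m ↦ (s m).2)

lemma smoothRT_iff_coord (hi : ContMDiff 𝓘(ℝ, F) 𝓘(ℝ, E) ∞ i) {U : Set M}
    (hU : U ⊆ chartDom F E i m₀) (s : ∀ m, RT F E i m) :
    SmoothRT i U s ↔ ContMDiffOn 𝓘(ℝ, F) 𝓘(ℝ, F × (E →L[ℝ] ℝ)) ∞
      (fun m ↦ rtCoord i m₀ m (s m)) U := by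
  unfold SmoothRT
  rw [smoothVecAlong_iff_coord (i := fun m : M ↦ m) (x₀ := m₀) contMDiffOn_id
      fun m hm ↦ (hU hm).1,
    smoothCovAlong_iff_coord (x₀ := i m₀) hi.contMDiffOn fun m hm ↦ (hU hm).2,
    contMDiffOn_prod_module_iff]
  rfl

end Coordinates

/-! ## Naturality of the Courant bracket -/

section VectorSpace

variable {E F : Type*} [NormedAddCommGroup E] [NormedSpace ℝ E]
  [NormedAddCommGroup F] [NormedSpace ℝ F] {f : F → E} {y : F}

/-- Lie brackets of `f`-related vector fields are `f`-related. -/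
lemma lieBracket_of_related (hf : ContDiffAt ℝ ∞ f y) {u v : E → E} {u' v' : F → F}
    (hu : DifferentiableAt ℝ u (f y)) (hv : DifferentiableAt ℝ v (f y))
    (hu' : DifferentiableAt ℝ u' y) (hv' : DifferentiableAt ℝ v' y)
    (huu' : ∀ᶠ z in 𝓝 y, u (f z) = fderiv ℝ f z (u' z))
    (hvv' : ∀ᶠ z in 𝓝 y, v (f z) = fderiv ℝ f z (v' z)) :
    VectorField.lieBracket ℝ u v (f y) = fderiv ℝ f y (VectorField.lieBracket ℝ u' v' y) := by
  have hfd : DifferentiableAt ℝ f y := hf.differentiableAt (by simp)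
  have hf' : DifferentiableAt ℝ (fderiv ℝ f) y :=
    (hf.fderiv_right (m := ∞) (by simp)).differentiableAt (by simp)
  -- Differentiating w ∘ f = Df · w' produces the second-derivative term D²f(a, w'); symmetry of D²f
  -- cancels these terms in the bracket.
  have key : ∀ {w : E → E} {w' : F → F}, DifferentiableAt ℝ w (f y) → DifferentiableAt ℝ w' y →
      (∀ᶠ z in 𝓝 y, w (f z) = fderiv ℝ f z (w' z)) → ∀ a,
      fderiv ℝ w (f y) (fderiv ℝ f y a) =
        fderiv ℝ f y (fderiv ℝ w' y a) + fderiv ℝ (fderiv ℝ f) y a (w' y) := by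
    intro w w' hw hw' h a
    have h1 : fderiv ℝ (fun z ↦ w (f z)) y = fderiv ℝ (fun z ↦ fderiv ℝ f z (w' z)) y :=
      Filter.EventuallyEq.fderiv_eq h
    rw [fderiv_clm_apply hf' hw', fderiv_fun_comp y hw hfd] at h1
    simpa using congrArg (fun L : F →L[ℝ] E ↦ L a) h1
  have hsymm : IsSymmSndFDerivAt ℝ f y := hf.isSymmSndFDerivAt (by
    rw [minSmoothness_of_isRCLikeNormedField]
    exact WithTop.coe_le_coe.2 (le_top : (2 : ℕ∞) ≤ ⊤))
  rw [VectorField.lieBracket, VectorField.lieBracket, huu'.self_of_nhds, hvv'.self_of_nhds,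
    key hu hu' huu', key hv hv' hvv', map_sub, hsymm.eq (u' y) (v' y)]
  abel

/-- The exterior derivative of `1`-forms commutes with pull back. -/
lemma fderiv_skew_of_related (hf : ContDiffAt ℝ ∞ f y) {α : E → (E →L[ℝ] ℝ)}
    {β : F → (F →L[ℝ] ℝ)} (hα : DifferentiableAt ℝ α (f y))
    (h : ∀ᶠ z in 𝓝 y, β z = (α (f z)).comp (fderiv ℝ f z)) (a b : F) :
    fderiv ℝ β y a b - fderiv ℝ β y b a =
      fderiv ℝ α (f y) (fderiv ℝ f y a) (fderiv ℝ f y b) -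
        fderiv ℝ α (f y) (fderiv ℝ f y b) (fderiv ℝ f y a) := by
  have hfd : DifferentiableAt ℝ f y := hf.differentiableAt (by simp)
  have hf' : DifferentiableAt ℝ (fderiv ℝ f) y :=
    (hf.fderiv_right (m := ∞) (by simp)).differentiableAt (by simp)
  have hsymm : IsSymmSndFDerivAt ℝ f y := hf.isSymmSndFDerivAt (by
    rw [minSmoothness_of_isRCLikeNormedField]
    exact WithTop.coe_le_coe.2 (le_top : (2 : ℕ∞) ≤ ⊤))
  have hαf : DifferentiableAt ℝ (fun z ↦ α (f z)) y := hα.fun_comp' y hfd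
  rw [Filter.EventuallyEq.fderiv_eq h, fderiv_clm_comp hαf hf', fderiv_fun_comp y hα hfd]
  simp [hsymm.eq a b]

end VectorSpace

/-! ### The bracket on manifolds, reduced to chart expressions. -/

section Manifold

variable {E : Type*} [NormedAddCommGroup E] [NormedSpace ℝ E]
  {X : Type*} [TopologicalSpace X] [ChartedSpace E X]

/-- A vector field in the chart at `x₀`. -/
def vecRep (u : ∀ x : X, Tan E x) (x₀ : X) (y : E) : E :=
  tanCoord x₀ ((extChartAt 𝓘(ℝ, E) x₀).symm y) (u ((extChartAt 𝓘(ℝ, E) x₀).symm y))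

/-- A `1`-form in the chart at `x₀`. -/
def covRep (η : ∀ x : X, Cot E x) (x₀ : X) (y : E) : E →L[ℝ] ℝ :=
  (η ((extChartAt 𝓘(ℝ, E) x₀).symm y)).comp
    (mfderiv 𝓘(ℝ, E) 𝓘(ℝ, E) (extChartAt 𝓘(ℝ, E) x₀).symm y)

/-- The differential at `y` of the inverse of the chart at `x₀`, with values regarded as tangent
vectors at `x`. -/
def symmDeriv (x₀ x : X) (y : E) : E →L[ℝ] Tan E x :=
  mfderiv 𝓘(ℝ, E) 𝓘(ℝ, E) (extChartAt 𝓘(ℝ, E) x₀).symm y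

variable [IsManifold 𝓘(ℝ, E) ∞ X] {x₀ x : X}

lemma tanCoord_self (x : X) (v : Tan E x) : tanCoord x x v = v := by
  unfold tanCoord
  rw [mfderiv_extChartAt_self]
  rfl

lemma tanFrame_self (x : X) (v : E) : tanFrame x x v = v := by
  have h := tanCoord_tanFrame (mem_chart_source E x) v
  rwa [tanCoord_self] at h

/-- `covRep` follows the formula inside `iotaD`, with the inverse chart differentiated at y;
`cotCoord` differentiates it at the chart image of the corresponding point. On the chart target
these are the same point. -/
lemma covRep_eq (η : ∀ x : X, Cot E x) {y : E} (hy : y ∈ (extChartAt 𝓘(ℝ, E) x₀).target) :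
    covRep η x₀ y = cotCoord x₀ ((extChartAt 𝓘(ℝ, E) x₀).symm y)
      (η ((extChartAt 𝓘(ℝ, E) x₀).symm y)) := by
  exact congrArg (fun z ↦ (η ((extChartAt 𝓘(ℝ, E) x₀).symm y)).comp (symmDeriv x₀ _ z))
    ((extChartAt 𝓘(ℝ, E) x₀).right_inv hy).symm

/-- The manifold bracket pulls fields back by inverting the derivative of the inverse chart; that
inverse is the derivative of the chart. -/
lemma mpullback_extChartAt_symm (u : ∀ x : X, Tan E x) {y : E}
    (hy : y ∈ (extChartAt 𝓘(ℝ, E) x₀).target) :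
    VectorField.mpullbackWithin 𝓘(ℝ, E) 𝓘(ℝ, E) (extChartAt 𝓘(ℝ, E) x₀).symm u
      (Set.range 𝓘(ℝ, E)) y = vecRep u x₀ y := by
  have h := isInvertible_mfderivWithin_extChartAt_symm hy
  have h2 := mfderiv_extChartAt_comp_mfderivWithin_extChartAt_symm hy
  rw [VectorField.mpullbackWithin_apply]
  obtain ⟨e, he⟩ := h
  rw [← he] at h2 ⊢
  rw [ContinuousLinearMap.inverse_equiv]
  have h3 := congrArg (fun L ↦ L (e.symm (u ((extChartAt 𝓘(ℝ, E) x₀).symm y)))) h2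
  simp only [ContinuousLinearMap.comp_apply, ContinuousLinearEquiv.coe_coe,
    ContinuousLinearEquiv.apply_symm_apply] at h3
  exact h3.symm

lemma mlieBracket_eq_lieBracket (u v : ∀ x : X, Tan E x) (x : X) :
    VectorField.mlieBracket 𝓘(ℝ, E) u v x =
      VectorField.lieBracket ℝ (vecRep u x) (vecRep v x) (extChartAt 𝓘(ℝ, E) x x) := by
  rw [← VectorField.mlieBracketWithin_univ, VectorField.mlieBracketWithin_apply,
    mfderiv_extChartAt_self]
  have hid : (ContinuousLinearMap.id ℝ (TangentSpace 𝓘(ℝ, E) x)).inverse =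
      ContinuousLinearMap.id ℝ (TangentSpace 𝓘(ℝ, E) x) := ContinuousLinearMap.inverse_id
  have key : ∀ w : ∀ x : X, Tan E x,
      VectorField.mpullbackWithin 𝓘(ℝ, E) 𝓘(ℝ, E) (extChartAt 𝓘(ℝ, E) x).symm w
        (Set.range 𝓘(ℝ, E)) =ᶠ[𝓝 (extChartAt 𝓘(ℝ, E) x x)] vecRep w x := fun w ↦ by
    filter_upwards [extChartAt_target_mem_nhds (I := 𝓘(ℝ, E)) x] with y hy
    exact mpullback_extChartAt_symm w hy
  have h := Filter.EventuallyEq.lieBracket_vectorField_eq (𝕜 := ℝ) (key u) (key v)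
  rw [← h]
  simp only [modelWithCornersSelf_coe, Set.range_id, Set.preimage_univ, Set.inter_univ]
  erw [hid]
  exact congrFun (VectorField.lieBracketWithin_univ (𝕜 := ℝ) (E := E)) _

/-- A chart has identity derivative at its own centre in the preferred trivialization, so the
factors dφ in `iotaD` disappear. -/
lemma iotaD_apply (η : ∀ x : X, Cot E x) (x : X) (a b : Tan E x) :
    iotaD η x a b = fderiv ℝ (covRep η x) (extChartAt 𝓘(ℝ, E) x x) a b -
      fderiv ℝ (covRep η x) (extChartAt 𝓘(ℝ, E) x x) b a := by
  change (fderiv ℝ (covRep η x) (extChartAt 𝓘(ℝ, E) x x) (tanCoord x x a) -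
    (fderiv ℝ (covRep η x) (extChartAt 𝓘(ℝ, E) x x)).flip (tanCoord x x a)) (tanCoord x x b) = _
  rw [tanCoord_self, tanCoord_self]
  rfl

lemma differentiableAt_vecRep {u : ∀ x : X, Tan E x} {U : Set X} (hU : IsOpen U) (hx : x ∈ U)
    (hu : SmoothVecAlong (F := E) (fun x : X ↦ x) U u) :
    DifferentiableAt ℝ (vecRep u x) (extChartAt 𝓘(ℝ, E) x x) := by
  have h1 := (smoothVecAlong_iff_coord (i := fun x : X ↦ x) (U := U ∩ (chartAt E x).source)
    (x₀ := x) contMDiffOn_id (fun y hy ↦ hy.2) u).1 (ContMDiffOn.mono hu Set.inter_subset_left)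
  have h2 := h1.contMDiffAt ((hU.inter (chartAt E x).open_source).mem_nhds
    ⟨hx, mem_chart_source E x⟩)
  have h3 := (contMDiffOn_extChartAt_symm (I := 𝓘(ℝ, E)) (n := ∞) x).contMDiffAt
    (extChartAt_target_mem_nhds (I := 𝓘(ℝ, E)) x)
  have h4 := (h2.comp_of_eq h3 (extChartAt_to_inv x)).contDiffAt.differentiableAt (by simp)
  exact h4

lemma differentiableAt_covRep {η : ∀ x : X, Cot E x} {U : Set X} (hU : IsOpen U) (hx : x ∈ U)
    (hη : SmoothCovAlong (F := E) (fun x : X ↦ x) U η) :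
    DifferentiableAt ℝ (covRep η x) (extChartAt 𝓘(ℝ, E) x x) := by
  have h1 := (smoothCovAlong_iff_coord (i := fun x : X ↦ x) (U := U ∩ (chartAt E x).source)
    (x₀ := x) contMDiffOn_id (fun y hy ↦ hy.2) η).1 (ContMDiffOn.mono hη Set.inter_subset_left)
  have h2 := h1.contMDiffAt ((hU.inter (chartAt E x).open_source).mem_nhds
    ⟨hx, mem_chart_source E x⟩)
  have h3 := (contMDiffOn_extChartAt_symm (I := 𝓘(ℝ, E)) (n := ∞) x).contMDiffAt
    (extChartAt_target_mem_nhds (I := 𝓘(ℝ, E)) x)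
  have h4 := (h2.comp_of_eq h3 (extChartAt_to_inv x)).contDiffAt.differentiableAt (by simp)
  refine h4.congr_of_eventuallyEq ?_
  filter_upwards [extChartAt_target_mem_nhds (I := 𝓘(ℝ, E)) x] with y hy
  exact covRep_eq η hy

lemma mdifferentiableAt_contraction {u : ∀ x : X, Tan E x} {η : ∀ x : X, Cot E x} {U : Set X}
    (hU : IsOpen U) (hx : x ∈ U) (hu : SmoothVecAlong (F := E) (fun x : X ↦ x) U u)
    (hη : SmoothCovAlong (F := E) (fun x : X ↦ x) U η) :
    MDifferentiableAt 𝓘(ℝ, E) 𝓘(ℝ, ℝ) (fun y ↦ η y (u y)) x := by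
  have h1 := (smoothVecAlong_iff_coord (i := fun x : X ↦ x) (U := U ∩ (chartAt E x).source)
    (x₀ := x) contMDiffOn_id (fun y hy ↦ hy.2) u).1 (ContMDiffOn.mono hu Set.inter_subset_left)
  have h2 := (smoothCovAlong_iff_coord (i := fun x : X ↦ x) (U := U ∩ (chartAt E x).source)
    (x₀ := x) contMDiffOn_id (fun y hy ↦ hy.2) η).1 (ContMDiffOn.mono hη Set.inter_subset_left)
  have h3 : ContMDiffOn 𝓘(ℝ, E) 𝓘(ℝ, ℝ) ∞ (fun y ↦ η y (u y)) (U ∩ (chartAt E x).source) := by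
    refine (h2.clm_apply h1).congr fun y hy ↦ ?_
    rw [cotCoord_apply, tanFrame_tanCoord hy.2]
  exact (h3.contMDiffAt ((hU.inter (chartAt E x).open_source).mem_nhds
    ⟨hx, mem_chart_source E x⟩)).mdifferentiableAt (by simp)

variable {F : Type*} [NormedAddCommGroup F] [NormedSpace ℝ F]
  {M : Type*} [TopologicalSpace M] [ChartedSpace F M] [IsManifold 𝓘(ℝ, F) ∞ M]
  {i : M → X} {m : M} {U : Set M}

/-- The elements `e` of `T_{i(m)} X ⊕ T*_{i(m)} X` and `e'` of `T_m M ⊕ T*_m M` are related by `i`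
if `e` comes from an element of `TM ⊕ T*X|_M` that `p` maps to `e'`. -/
def Related (i : M → X) (m : M) (e : GT E (i m)) (e' : GT F m) : Prop :=
  e.1 = dmap F E i m e'.1 ∧ pullCot i m e.2 = e'.2

lemma fderiv_localRep_self (hi : ContMDiff 𝓘(ℝ, F) 𝓘(ℝ, E) ∞ i) (m : M) (a : Tan F m) :
    fderiv ℝ (localRep F E i m) (extChartAt 𝓘(ℝ, F) m m) a = dmap F E i m a := by
  rw [← dCoord_eq_fderiv hi (mem_chartDom i m)]
  exact (tanCoord_self _ _).trans (congrArg (dmap F E i m) (tanFrame_self (E := F) m a))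

lemma localRep_extChartAt_self (i : M → X) (m : M) :
    localRep F E i m (extChartAt 𝓘(ℝ, F) m m) = extChartAt 𝓘(ℝ, E) (i m) (i m) := by
  rw [localRep, extChartAt_to_inv]

lemma contDiffAt_localRep (hi : ContMDiff 𝓘(ℝ, F) 𝓘(ℝ, E) ∞ i) (m : M) :
    ContDiffAt ℝ ∞ (localRep F E i m) (extChartAt 𝓘(ℝ, F) m m) :=
  (contDiffOn_localRep hi m).contDiffAt ((isOpen_chartDom_coord hi.continuous m).mem_nhds
    (mapsTo_chartDom_coord (mem_chartDom i m)))

lemma eventually_symm_mem (hi : ContMDiff 𝓘(ℝ, F) 𝓘(ℝ, E) ∞ i) (hU : IsOpen U) (hm : m ∈ U) :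
    ∀ᶠ y in 𝓝 (extChartAt 𝓘(ℝ, F) m m), y ∈ (extChartAt 𝓘(ℝ, F) m).target ∧
      (extChartAt 𝓘(ℝ, F) m).symm y ∈ chartDom F E i m ∧ (extChartAt 𝓘(ℝ, F) m).symm y ∈ U := by
  filter_upwards [(isOpen_chartDom_coord hi.continuous m).mem_nhds
    (mapsTo_chartDom_coord (E := E) (mem_chartDom i m)),
    (continuousAt_extChartAt_symm m).preimage_mem_nhds
      (by rw [extChartAt_to_inv]; exact hU.mem_nhds hm)] with y hy hy'
  exact ⟨hy.1, hy.2, hy'⟩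

lemma localRep_symm {y : F}
    (hy : (extChartAt 𝓘(ℝ, F) m).symm y ∈ chartDom F E i m) :
    (extChartAt 𝓘(ℝ, E) (i m)).symm (localRep F E i m y) =
      i ((extChartAt 𝓘(ℝ, F) m).symm y) := by
  refine (extChartAt 𝓘(ℝ, E) (i m)).left_inv ?_
  rw [extChartAt_source]
  exact hy.2

lemma localRep_mem_target {y : F}
    (hy : (extChartAt 𝓘(ℝ, F) m).symm y ∈ chartDom F E i m) :
    localRep F E i m y ∈ (extChartAt 𝓘(ℝ, E) (i m)).target := by
  refine (extChartAt 𝓘(ℝ, E) (i m)).map_source ?_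
  rw [extChartAt_source]
  exact hy.2

lemma fderiv_localRep_eq (hi : ContMDiff 𝓘(ℝ, F) 𝓘(ℝ, E) ∞ i) {y : F}
    (hy : y ∈ (extChartAt 𝓘(ℝ, F) m).target)
    (hy' : (extChartAt 𝓘(ℝ, F) m).symm y ∈ chartDom F E i m) :
    fderiv ℝ (localRep F E i m) y = dCoord F E i m ((extChartAt 𝓘(ℝ, F) m).symm y) := by
  rw [dCoord_eq_fderiv hi hy', (extChartAt 𝓘(ℝ, F) m).right_inv hy]

lemma eventually_vecRep_related (hi : ContMDiff 𝓘(ℝ, F) 𝓘(ℝ, E) ∞ i) (hU : IsOpen U)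
    (hm : m ∈ U) {u : ∀ x : X, Tan E x} {u' : ∀ m : M, Tan F m}
    (h : ∀ m ∈ U, u (i m) = dmap F E i m (u' m)) :
    ∀ᶠ y in 𝓝 (extChartAt 𝓘(ℝ, F) m m), vecRep u (i m) (localRep F E i m y) =
      fderiv ℝ (localRep F E i m) y (vecRep u' m y) := by
  filter_upwards [eventually_symm_mem hi hU hm] with y hy
  rw [fderiv_localRep_eq hi hy.1 hy.2.1, vecRep, vecRep, ← tanCoord_dmap hy.2.1,
    localRep_symm hy.2.1, h _ hy.2.2]

lemma eventually_covRep_related (hi : ContMDiff 𝓘(ℝ, F) 𝓘(ℝ, E) ∞ i) (hU : IsOpen U)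
    (hm : m ∈ U) {η : ∀ x : X, Cot E x} {η' : ∀ m : M, Cot F m}
    (h : ∀ m ∈ U, pullCot i m (η (i m)) = η' m) :
    ∀ᶠ y in 𝓝 (extChartAt 𝓘(ℝ, F) m m), covRep η' m y =
      (covRep η (i m) (localRep F E i m y)).comp (fderiv ℝ (localRep F E i m) y) := by
  filter_upwards [eventually_symm_mem hi hU hm] with y hy
  rw [fderiv_localRep_eq hi hy.1 hy.2.1, covRep_eq _ hy.1,
    covRep_eq _ (localRep_mem_target hy.2.1), ← h _ hy.2.2, cotCoord_pullCot hy.2.1,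
    localRep_symm hy.2.1]

lemma mlieBracket_of_related (hi : ContMDiff 𝓘(ℝ, F) 𝓘(ℝ, E) ∞ i) (hU : IsOpen U)
    (hm : m ∈ U) {O : Set X} (hO : IsOpen O) (hmO : i m ∈ O)
    {u v : ∀ x : X, Tan E x} {u' v' : ∀ m : M, Tan F m}
    (hu : SmoothVecAlong (F := E) (fun x : X ↦ x) O u)
    (hv : SmoothVecAlong (F := E) (fun x : X ↦ x) O v)
    (hu' : SmoothVecAlong (F := F) (fun m : M ↦ m) U u')
    (hv' : SmoothVecAlong (F := F) (fun m : M ↦ m) U v')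
    (huu' : ∀ m ∈ U, u (i m) = dmap F E i m (u' m))
    (hvv' : ∀ m ∈ U, v (i m) = dmap F E i m (v' m)) :
    VectorField.mlieBracket 𝓘(ℝ, E) u v (i m) =
      dmap F E i m (VectorField.mlieBracket 𝓘(ℝ, F) u' v' m) := by
  have key := lieBracket_of_related (contDiffAt_localRep hi m)
    (by rw [localRep_extChartAt_self]; exact differentiableAt_vecRep hO hmO hu)
    (by rw [localRep_extChartAt_self]; exact differentiableAt_vecRep hO hmO hv)
    (differentiableAt_vecRep hU hm hu')
    (differentiableAt_vecRep hU hm hv') (eventually_vecRep_related hi hU hm huu')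
    (eventually_vecRep_related hi hU hm hvv')
  rw [localRep_extChartAt_self] at key
  exact (mlieBracket_eq_lieBracket u v (i m)).trans (key.trans ((fderiv_localRep_self hi m _).trans
    (congrArg (dmap F E i m) (mlieBracket_eq_lieBracket u' v' m).symm)))

lemma iotaD_of_related (hi : ContMDiff 𝓘(ℝ, F) 𝓘(ℝ, E) ∞ i) (hU : IsOpen U)
    (hm : m ∈ U) {O : Set X} (hO : IsOpen O) (hmO : i m ∈ O)
    {η : ∀ x : X, Cot E x} {η' : ∀ m : M, Cot F m}
    (hη : SmoothCovAlong (F := E) (fun x : X ↦ x) O η)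
    (h : ∀ m ∈ U, pullCot i m (η (i m)) = η' m) (a : Tan F m) :
    pullCot i m (iotaD η (i m) (dmap F E i m a)) = iotaD η' m a := by
  refine ContinuousLinearMap.ext fun b ↦ ?_
  change iotaD η (i m) (dmap F E i m a) (dmap F E i m b) = _
  have hd : DifferentiableAt ℝ (covRep η (i m))
      (localRep F E i m (extChartAt 𝓘(ℝ, F) m m)) := by
    rw [localRep_extChartAt_self]; exact differentiableAt_covRep hO hmO hη
  have key := fderiv_skew_of_related (contDiffAt_localRep hi m) hd
    (eventually_covRep_related hi hU hm h) a b
  rw [localRep_extChartAt_self] at key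
  refine (iotaD_apply _ _ _ _).trans (Eq.trans ?_ (key.symm.trans (iotaD_apply _ _ _ _).symm))
  rw [← fderiv_localRep_self hi m a, ← fderiv_localRep_self hi m b]

/-- Relatedness gives η(u) ∘ i = η'(u') near m, since (i^*η)(u') = η(i_* u'); the chain rule does
the rest. -/
lemma dFun_of_related (hi : ContMDiff 𝓘(ℝ, F) 𝓘(ℝ, E) ∞ i) (hU : IsOpen U)
    (hm : m ∈ U) {O : Set X} (hO : IsOpen O) (hmO : i m ∈ O)
    {u : ∀ x : X, Tan E x} {u' : ∀ m : M, Tan F m}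
    (hu : SmoothVecAlong (F := E) (fun x : X ↦ x) O u)
    (huu' : ∀ m ∈ U, u (i m) = dmap F E i m (u' m))
    {η : ∀ x : X, Cot E x} {η' : ∀ m : M, Cot F m}
    (hη : SmoothCovAlong (F := E) (fun x : X ↦ x) O η)
    (h : ∀ m ∈ U, pullCot i m (η (i m)) = η' m) :
    pullCot i m (dFun (E := E) (fun x ↦ η x (u x)) (i m)) =
      dFun (E := F) (fun m ↦ η' m (u' m)) m := by
  have h1 := mdifferentiableAt_contraction hO hmO hu hη
  have h2 : (fun m ↦ η' m (u' m)) =ᶠ[𝓝 m] (fun x ↦ η x (u x)) ∘ i := by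
    filter_upwards [hU.mem_nhds hm] with m' hm'
    rw [← h m' hm', Function.comp_apply, huu' m' hm']
    rfl
  have h3 := (h1.hasMFDerivAt.comp m (hi.mdifferentiable (by simp) m).hasMFDerivAt).mfderiv
  rw [← h2.mfderiv_eq] at h3
  exact h3.symm

/-- The Courant brackets of `i`-related sections are `i`-related. -/
theorem courant_of_related (hi : ContMDiff 𝓘(ℝ, F) 𝓘(ℝ, E) ∞ i) (hU : IsOpen U)
    (hm : m ∈ U) {O : Set X} (hO : IsOpen O) (hmO : i m ∈ O)
    {s t : ∀ x : X, GT E x} {s' t' : ∀ m : M, GT F m}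
    (hs : SmoothGT O s) (ht : SmoothGT O t) (hs' : SmoothGT U s') (ht' : SmoothGT U t')
    (hss' : ∀ m ∈ U, Related i m (s (i m)) (s' m))
    (htt' : ∀ m ∈ U, Related i m (t (i m)) (t' m)) :
    Related i m (courant s t (i m)) (courant s' t' m) := by
  have hi1 := iotaD_of_related hi hU hm hO hmO hs.2 (fun m hm ↦ (hss' m hm).2)
  have hi2 := iotaD_of_related hi hU hm hO hmO ht.2 (fun m hm ↦ (htt' m hm).2)
  have hd1 := dFun_of_related hi hU hm hO hmO hs.1 (fun m hm ↦ (hss' m hm).1) ht.2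
    (fun m hm ↦ (htt' m hm).2)
  have hd2 := dFun_of_related hi hU hm hO hmO ht.1 (fun m hm ↦ (htt' m hm).1) hs.2
    (fun m hm ↦ (hss' m hm).2)
  refine ⟨mlieBracket_of_related hi hU hm hO hmO hs.1 ht.1 hs'.1 ht'.1
    (fun m hm ↦ (hss' m hm).1) (fun m hm ↦ (htt' m hm).1), ?_⟩
  simp only [courant, lieD, map_smul, map_add, map_sub]
  rw [hd1, hd2, (hss' m hm).1, (htt' m hm).1, hi1, hi2]

lemma Related.add {e₁ e₂ : GT E (i m)} {e₁' e₂' : GT F m} (h₁ : Related i m e₁ e₁')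
    (h₂ : Related i m e₂ e₂') : Related i m (e₁ + e₂) (e₁' + e₂') := by
  refine ⟨?_, ?_⟩
  · rw [Prod.fst_add, Prod.fst_add, map_add, h₁.1, h₂.1]
  · rw [Prod.snd_add, Prod.snd_add, map_add, h₁.2, h₂.2]

lemma Related.sub {e₁ e₂ : GT E (i m)} {e₁' e₂' : GT F m} (h₁ : Related i m e₁ e₁')
    (h₂ : Related i m e₂ e₂') : Related i m (e₁ - e₂) (e₁' - e₂') := by
  refine ⟨?_, ?_⟩
  · rw [Prod.fst_sub, Prod.fst_sub, map_sub, h₁.1, h₂.1]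
  · rw [Prod.snd_sub, Prod.snd_sub, map_sub, h₁.2, h₂.2]

end Manifold

/-! ## Linear algebra along a submanifold -/

section Pointwise

variable {E : Type*} [NormedAddCommGroup E] [NormedSpace ℝ E]
  {X : Type*} [TopologicalSpace X] [ChartedSpace E X]
  {F : Type*} [NormedAddCommGroup F] [NormedSpace ℝ F]
  {M : Type*} [TopologicalSpace M] [ChartedSpace F M]

instance [FiniteDimensional ℝ E] (x : X) : FiniteDimensional ℝ (Tan E x) :=
  inferInstanceAs (FiniteDimensional ℝ E)

instance [FiniteDimensional ℝ E] (x : X) : FiniteDimensional ℝ (Cot E x) :=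
  inferInstanceAs (FiniteDimensional ℝ (E →L[ℝ] ℝ))

lemma finrank_cot [FiniteDimensional ℝ E] (x : X) :
    Module.finrank ℝ (Cot E x) = Module.finrank ℝ E :=
  (LinearMap.toContinuousLinearMap (𝕜 := ℝ) (E := E) (F' := ℝ)).finrank_eq.symm.trans
    (Subspace.dual_finrank_eq)

lemma finrank_GT [FiniteDimensional ℝ E] (x : X) :
    Module.finrank ℝ (GT E x) = 2 * Module.finrank ℝ E := by
  rw [Module.finrank_prod, finrank_cot, two_mul]
  rfl

variable {i : M → X} {m : M}

lemma incl_apply (e : RT F E i m) : incl i m e = (dmap F E i m e.1, e.2) := rfl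

lemma pmap_apply (e : RT F E i m) : pmap i m e = (e.1, pullCot i m e.2) := rfl

lemma incl_injective (hd : Function.Injective (dmap F E i m)) :
    Function.Injective (incl (F := F) (E := E) i m) := by
  intro e₁ e₂ h
  rw [incl_apply, incl_apply, Prod.mk.injEq] at h
  exact Prod.ext (hd h.1) h.2

/-- Thus p preserves the pairing: ξ(i_* u) = (i^* ξ)(u) holds by definition. -/
lemma pairing_incl (e₁ e₂ : RT F E i m) :
    pairing (incl i m e₁) (incl i m e₂) = pairing (pmap i m e₁) (pmap i m e₂) := rfl

lemma incl_mem_conormal {e : RT F E i m} (he : pmap i m e = 0) :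
    incl i m e ∈ conormal F i m := by
  rw [pmap_apply, Prod.mk_eq_zero] at he
  refine ⟨?_, he.2⟩
  rw [incl_apply, he.1, map_zero]
  exact Submodule.zero_mem _

lemma pmap_eq_zero (hd : Function.Injective (dmap F E i m)) {e : RT F E i m}
    (he : incl i m e ∈ conormal F i m) : pmap i m e = 0 := by
  rw [pmap_apply, Prod.mk_eq_zero]
  refine ⟨hd ?_, he.2⟩
  rw [map_zero]
  exact he.1

lemma pairing_conormal (e : RT F E i m) {n : GT E (i m)} (hn : n ∈ conormal F i m) :
    pairing (incl i m e) n = 0 := by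
  have h1 : n.1 = 0 := hn.1
  have h2 : n.2 (dmap F E i m e.1) = 0 :=
    congrArg (fun L : Cot F m ↦ L e.1) (show pullCot i m n.2 = 0 from hn.2)
  simp [pairing, incl_apply, h1, h2]

/-- A vector outside the image of the differential is separated from it by a functional, which is
continuous in finite dimension and is therefore a conormal covector. -/
lemma mem_range_dmap [FiniteDimensional ℝ E] {v : Tan E (i m)}
    (h : ∀ ξ : Cot E (i m), pullCot (F := F) i m ξ = 0 → ξ v = 0) :
    ∃ u, dmap F E i m u = v := by
  by_contra hv
  obtain ⟨f, hf, hle⟩ := Submodule.exists_le_ker_of_notMem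
    (p := LinearMap.range (dmap F E i m).toLinearMap) (v := v) fun ⟨u, hu⟩ ↦ hv ⟨u, hu⟩
  refine hf (h (LinearMap.toContinuousLinearMap (𝕜 := ℝ) (E := E) (F' := ℝ) f) ?_)
  exact ContinuousLinearMap.ext fun u ↦ hle ⟨u, rfl⟩

/-- `TM ⊕ T*X|_M` contains the orthogonal complement of the conormal bundle. -/
lemma mem_range_incl [FiniteDimensional ℝ E] {v : GT E (i m)}
    (h : ∀ n ∈ conormal F i m, pairing v n = 0) : ∃ e, incl (F := F) i m e = v := by
  obtain ⟨u, hu⟩ := mem_range_dmap (F := F) (i := i) (m := m) (v := v.1) fun ξ hξ ↦ by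
    have := h (0, ξ) ⟨Submodule.zero_mem _, hξ⟩
    simpa [pairing] using this
  exact ⟨(u, v.2), by rw [incl_apply, hu]⟩

/-- A covector on M extends by composition with a linear left inverse of the differential. -/
lemma pullCot_surjective [FiniteDimensional ℝ E] [FiniteDimensional ℝ F]
    (hd : Function.Injective (dmap F E i m)) :
    Function.Surjective (pullCot (F := F) (E := E) i m) := by
  intro ζ
  obtain ⟨g, hg⟩ := (dmap F E i m).toLinearMap.exists_leftInverse_of_injective
    (LinearMap.ker_eq_bot.2 hd)
  let g' : Tan E (i m) →L[ℝ] Tan F m := LinearMap.toContinuousLinearMap (𝕜 := ℝ) (E := E) (F' := F) g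
  refine ⟨ζ.comp g', ContinuousLinearMap.ext fun u ↦ ?_⟩
  exact congrArg ζ (LinearMap.congr_fun hg u)

/-- The largest `J`-invariant subspace of `TM ⊕ T*X|_M`. -/
def invariantPart (F : Type*) [NormedAddCommGroup F] [NormedSpace ℝ F] {M : Type*}
    [TopologicalSpace M] [ChartedSpace F M] (i : M → X) (J : EndField E X) (m : M) :
    Submodule ℝ (RT F E i m) :=
  (LinearMap.range (incl (F := F) i m)).comap (J (i m) ∘ₗ incl i m)

lemma mem_invariantPart {J : EndField E X} {e : RT F E i m} :
    e ∈ invariantPart F i J m ↔ ∃ e' : RT F E i m, J (i m) (incl i m e) = incl i m e' := by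
  unfold invariantPart
  rw [Submodule.mem_comap, LinearMap.mem_range]
  exact exists_congr fun _ ↦ eq_comm

/-- The conditions on `J` under which it descends to `TM ⊕ T*M`: the `J`-invariant part of
`TM ⊕ T*X|_M` maps onto `TM ⊕ T*M`, and `J` preserves the kernel of this map. -/
structure Descends (F : Type*) [NormedAddCommGroup F] [NormedSpace ℝ F] {M : Type*}
    [TopologicalSpace M] [ChartedSpace F M] (i : M → X) (J : EndField E X) : Prop where
  ker : ∀ (m : M) (e e' : RT F E i m), J (i m) (incl i m e) = incl i m e' →
    pmap i m e = 0 → pmap i m e' = 0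
  surj : ∀ (m : M) (ε : GT F m), ∃ e e' : RT F E i m,
    pmap i m e = ε ∧ J (i m) (incl i m e) = incl i m e'

variable {J J₀ J₁ : EndField E X}

lemma cplx_mem_LM (hJ : ∀ x, J x * J x = -1) {a b : RT F E i m} :
    cplx a b ∈ LM F i J m ↔ J (i m) (incl i m a) = incl i m b := by
  unfold LM eigenL
  rw [Submodule.mem_comap, baseChange_cplx, cplx_mem_eigenspace (hJ _)]

lemma cplx_mem_LN (hd : Function.Injective (dmap F E i m)) (hJ : ∀ x, J x * J x = -1)
    {a b : RT F E i m} :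
    cplx a b ∈ LN F i J m ↔
      J (i m) (incl i m a) = incl i m b ∧ pmap i m a = 0 ∧ pmap i m b = 0 := by
  unfold LN
  rw [Submodule.mem_inf, cplx_mem_LM hJ, cplx_mem_baseChange, Submodule.mem_comap,
    Submodule.mem_comap]
  exact and_congr_right fun _ ↦ and_congr ⟨pmap_eq_zero hd, incl_mem_conormal⟩
    ⟨pmap_eq_zero hd, incl_mem_conormal⟩

/-- Elements of L_J(M) are e + √-1 J e, so the real and imaginary parts of the two eigenvalue
conditions all reduce to J_M p e = p J e on the invariant part. -/
lemma isInduced_iff (hJ : ∀ x, J x * J x = -1) {JM : EndField F M} :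
    IsInduced i J JM ↔ ∀ (m : M) (e e' : RT F E i m),
      J (i m) (incl i m e) = incl i m e' → JM m (pmap i m e) = pmap i m e' := by
  refine forall_congr' fun m ↦ ⟨fun h e e' he ↦ ?_, fun h ↦ ⟨fun z hz ↦ ?_, fun z hz ↦ ?_⟩⟩
  · have h1 := h.1 _ ((cplx_mem_LM hJ).2 he)
    rw [baseChange_cplx, baseChange_cplx, neg_I_smul_cplx, cplx_inj] at h1
    exact h1.1
  · obtain ⟨a, b, rfl⟩ := exists_cplx z
    rw [cplx_mem_LM hJ] at hz
    have hz' : J (i m) (incl i m b) = incl i m (-a) := by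
      rw [← hz, apply_apply_of_sq (hJ _), map_neg]
    rw [baseChange_cplx, baseChange_cplx, neg_I_smul_cplx, h a b hz, h b _ hz', map_neg]
  · obtain ⟨a, b, rfl⟩ := exists_cplx z
    rw [cplx_mem_conjSub, cplx_mem_LM hJ] at hz
    have hz' : J (i m) (incl i m b) = incl i m a := by
      rw [← neg_inj, ← map_neg, ← map_neg, ← hz, apply_apply_of_sq (hJ _)]
    rw [baseChange_cplx, baseChange_cplx, I_smul_cplx, h a _ hz, h b _ hz', map_neg]

lemma Descends.surjective (hJ : ∀ x, J x * J x = -1) (h : Descends F i J) (m : M) :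
    (LM F i J m ⊔ conjSub (LM F i J m)).map ((pmap i m).baseChange ℂ) = ⊤ := by
  have key (ε : GT F m) : ∃ e : RT F E i m, pmap i m e = ε ∧
      cplx e 0 ∈ LM F i J m ⊔ conjSub (LM F i J m) := by
    obtain ⟨e, e', h1, h2⟩ := h.surj m ε
    refine ⟨e, h1, ?_⟩
    -- A real vector of the invariant part is half the sum of e + √-1 J e and its conjugate.
    have h3 : cplx e 0 = (1 / 2 : ℂ) • (cplx e e' + cplx e (-e')) := by
      rw [cplx_add, smul_cplx, cplx_inj]
      constructor
      · simp [← two_smul ℝ e, smul_smul]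
      · simp
    rw [h3]
    refine Submodule.smul_mem _ _ (Submodule.add_mem_sup ((cplx_mem_LM hJ).2 h2) ?_)
    rw [cplx_mem_conjSub, neg_neg]
    exact (cplx_mem_LM hJ).2 h2
  rw [eq_top_iff]
  rintro z -
  obtain ⟨a, b, rfl⟩ := exists_cplx z
  obtain ⟨e, h1, h2⟩ := key a
  obtain ⟨f, h3, h4⟩ := key b
  refine ⟨cplx e 0 + Complex.I • cplx f 0, add_mem h2 (Submodule.smul_mem _ _ h4), ?_⟩
  rw [I_smul_cplx, cplx_add, baseChange_cplx]
  simp [h1, h3]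

/-- Because J preserves ker p, a sum of an element of L_J(M) and one of its conjugate lies in (ker
p)^ℂ only if both summands do. -/
lemma Descends.exact_middle (hd : Function.Injective (dmap F E i m))
    (hJ : ∀ x, J x * J x = -1) (h : Descends F i J) :
    LN F i J m ⊔ conjSub (LN F i J m) =
      (LM F i J m ⊔ conjSub (LM F i J m)) ⊓ LinearMap.ker ((pmap i m).baseChange ℂ) := by
  have h1 : LN F i J m ≤ LM F i J m := inf_le_left
  refine le_antisymm (le_inf (sup_le_sup h1 (Submodule.map_mono h1)) (sup_le ?_ ?_)) ?_
  · intro z hz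
    obtain ⟨a, b, rfl⟩ := exists_cplx z
    exact cplx_mem_ker_baseChange.2 ((cplx_mem_LN hd hJ).1 hz).2
  · intro z hz
    obtain ⟨a, b, rfl⟩ := exists_cplx z
    rw [cplx_mem_conjSub, cplx_mem_LN hd hJ, map_neg (pmap i m), neg_eq_zero] at hz
    exact cplx_mem_ker_baseChange.2 hz.2
  · rintro z ⟨hz, hz'⟩
    obtain ⟨z₁, h₁, z₂, h₂, rfl⟩ := Submodule.mem_sup.1 hz
    obtain ⟨a, b, rfl⟩ := exists_cplx z₁
    obtain ⟨c, d, rfl⟩ := exists_cplx z₂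
    rw [cplx_add] at hz'
    obtain ⟨hac, hbd⟩ := cplx_mem_ker_baseChange.1 hz'
    rw [cplx_mem_LM hJ] at h₁
    rw [cplx_mem_conjSub, cplx_mem_LM hJ] at h₂
    -- Here J a = b and J c = -d, so J(a + c) = b - d and J(b + d) = c - a also lie in ker p.
    -- Together with a + c and b + d this puts all four vectors in ker p.
    have hbd' := h.ker m (a + c) (b - d) (by
      rw [map_add, map_add, h₁, h₂, ← map_add, sub_eq_add_neg]) hac
    have hac' := h.ker m (b + d) (c - a) (by
      have h₁' : J (i m) (incl i m b) = incl i m (-a) := by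
        rw [← h₁, apply_apply_of_sq (hJ _), map_neg]
      have h₂' : J (i m) (incl i m d) = incl i m c := by
        rw [← neg_inj, ← map_neg, ← map_neg, ← h₂, apply_apply_of_sq (hJ _)]
      rw [map_add, map_add, h₁', h₂', ← map_add]; congr 1; abel) hbd
    rw [map_add] at hac hbd
    rw [map_sub] at hac' hbd'
    have two {v : GT F m} (hv : v + v = 0) : v = 0 := by
      rw [← two_smul ℝ v] at hv
      exact (smul_eq_zero.1 hv).resolve_left two_ne_zero
    have hpc : pmap i m c = 0 := two (by nth_rw 2 [sub_eq_zero.1 hac']; rwa [add_comm])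
    have hpb : pmap i m b = 0 := two (by nth_rw 2 [sub_eq_zero.1 hbd']; exact hbd)
    rw [hpc, add_zero] at hac
    rw [hpb, zero_add] at hbd
    refine Submodule.add_mem_sup ((cplx_mem_LN hd hJ).2 ⟨h₁, hac, hpb⟩) ?_
    rw [cplx_mem_conjSub, cplx_mem_LN hd hJ]
    exact ⟨h₂, hpc, by rw [map_neg, hbd, neg_zero]⟩

/-- A choice of the lifts of elements of `TM ⊕ T*M` to the `J`-invariant part of
`TM ⊕ T*X|_M`. -/
structure IsLift (i : M → X) (J : EndField E X) (σ : ∀ m : M, GT F m →ₗ[ℝ] RT F E i m) :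
    Prop where
  pmap_apply : ∀ (m : M) (ε : GT F m), pmap i m (σ m ε) = ε
  mem : ∀ (m : M) (ε : GT F m), ∃ e' : RT F E i m, J (i m) (incl i m (σ m ε)) = incl i m e'

/-- Each fibre of σ is a linear right inverse of p on the invariant part. In general it is a choice
without any regularity; it is canonical when the invariant part meets ker p trivially. -/
lemma Descends.exists_isLift (h : Descends F i J) :
    ∃ σ : ∀ m : M, GT F m →ₗ[ℝ] RT F E i m, IsLift i J σ := by
  have key (m : M) : ∃ σ : GT F m →ₗ[ℝ] RT F E i m, ∀ ε, pmap i m (σ ε) = ε ∧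
      ∃ e' : RT F E i m, J (i m) (incl i m (σ ε)) = incl i m e' := by
    let f : invariantPart F i J m →ₗ[ℝ] GT F m := (pmap i m) ∘ₗ Submodule.subtype _
    have hf : LinearMap.range f = ⊤ := by
      rw [eq_top_iff]
      rintro ε -
      obtain ⟨e, e', h1, h2⟩ := h.surj m ε
      exact ⟨⟨e, mem_invariantPart.2 ⟨e', h2⟩⟩, h1⟩
    obtain ⟨g, hg⟩ := f.exists_rightInverse_of_surjective hf
    exact ⟨Submodule.subtype _ ∘ₗ g, fun ε ↦
      ⟨LinearMap.congr_fun hg ε, mem_invariantPart.1 (g ε).2⟩⟩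
  choose σ hσ using key
  exact ⟨σ, fun m ε ↦ (hσ m ε).1, fun m ε ↦ (hσ m ε).2⟩

/-- The operator is p J σ. Two lifts of the same element differ by a vector of ker p, which J keeps
there, so the lift does not matter; uniqueness holds because every element has a lift. -/
lemma Descends.existsUnique_isInduced (hd : ∀ m, Function.Injective (dmap F E i m))
    (hJ : ∀ x, J x * J x = -1) (h : Descends F i J) :
    ∃! JM : EndField F M, IsInduced i J JM := by
  obtain ⟨σ, hσ⟩ := h.exists_isLift
  choose g hg using fun m ↦ (incl (F := F) (E := E) i m).exists_leftInverse_of_injective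
    (LinearMap.ker_eq_bot.2 (incl_injective (hd m)))
  refine ⟨fun m ↦ pmap i m ∘ₗ g m ∘ₗ J (i m) ∘ₗ incl i m ∘ₗ σ m, (isInduced_iff hJ).2 ?_, ?_⟩
  · intro m e e' he
    obtain ⟨e'', he''⟩ := hσ.mem m (pmap i m e)
    have h1 := h.ker m (e - σ m (pmap i m e)) (e' - e'') (by
      rw [map_sub, map_sub, he, he'', map_sub]) (by rw [map_sub, hσ.pmap_apply, sub_self])
    rw [map_sub, sub_eq_zero] at h1
    change pmap i m (g m (J (i m) (incl i m (σ m (pmap i m e))))) = _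
    rw [he'', h1]
    exact congrArg _ (LinearMap.congr_fun (hg m) e'')
  · intro JM hJM
    rw [isInduced_iff hJ] at hJM
    funext m
    refine LinearMap.ext fun ε ↦ ?_
    obtain ⟨e', he'⟩ := hσ.mem m ε
    have h1 := hJM m _ _ he'
    rw [hσ.pmap_apply] at h1
    change _ = pmap i m (g m (J (i m) (incl i m (σ m ε))))
    rw [h1, he']
    exact (congrArg _ (LinearMap.congr_fun (hg m) e')).symm

/-! ### Generalized Kähler structures with invariant conormal bundle -/

variable [IsManifold 𝓘(ℝ, E) ∞ X]

lemma apply_mem_conormal (hN : ConormalInvariant F i J₀) {n : GT E (i m)}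
    (hn : n ∈ conormal F i m) : J₀ (i m) n ∈ conormal F i m := by
  rw [← hN m]
  exact ⟨n, hn, rfl⟩

/-- An orthogonal map preserving N* preserves its orthogonal complement, which is TM ⊕ T*X|_M. -/
lemma exists_incl_of_conormalInvariant [FiniteDimensional ℝ E]
    (hJ₀ : ∀ (x : X) (e₁ e₂ : GT E x), pairing (J₀ x e₁) (J₀ x e₂) = pairing e₁ e₂)
    (hN : ConormalInvariant F i J₀) (e : RT F E i m) :
    ∃ e' : RT F E i m, J₀ (i m) (incl i m e) = incl i m e' := by
  obtain ⟨e', he'⟩ := mem_range_incl (F := F) (v := J₀ (i m) (incl i m e)) fun n hn ↦ by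
    rw [← hN m] at hn
    obtain ⟨n', hn', rfl⟩ := hn
    rw [hJ₀]
    exact pairing_conormal e hn'
  exact ⟨e', he'.symm⟩

lemma descends_of_conormalInvariant [FiniteDimensional ℝ E] [FiniteDimensional ℝ F]
    (hd : ∀ m, Function.Injective (dmap F E i m))
    (hJ₀ : ∀ (x : X) (e₁ e₂ : GT E x), pairing (J₀ x e₁) (J₀ x e₂) = pairing e₁ e₂)
    (hN : ConormalInvariant F i J₀) : Descends F i J₀ where
  ker m e e' he hp := by
    refine pmap_eq_zero (hd m) ?_
    rw [← he]
    exact apply_mem_conormal hN (incl_mem_conormal hp)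
  surj m ε := by
    obtain ⟨ξ, hξ⟩ := pullCot_surjective (hd m) ε.2
    obtain ⟨e', he'⟩ := exists_incl_of_conormalInvariant hJ₀ hN (m := m) (ε.1, ξ)
    exact ⟨(ε.1, ξ), e', by rw [pmap_apply, hξ], he'⟩

/-- The `J₁`-invariant part of the conormal bundle vanishes. -/
lemma eq_zero_of_conormal (hd : Function.Injective (dmap F E i m))
    (hJ : IsGeneralizedKahler J₀ J₁) (hN : ConormalInvariant F i J₀) {e e' : RT F E i m}
    (he : J₁ (i m) (incl i m e) = incl i m e') (hp : pmap i m e = 0) : e = 0 := by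
  have h1 := apply_mem_conormal hN (incl_mem_conormal hp)
  by_contra hne
  have hne' : incl i m e ≠ 0 := fun h ↦ hne (incl_injective hd (h.trans (map_zero _).symm))
  refine (hJ.metric.pos (i m) _ hne').ne' ?_
  -- Applying J₀ to both arguments turns ⟨G e, e⟩ into ⟨J₁ e, J₀ e⟩, a pairing of TM ⊕ T*X|_M with
  -- N*.
  rw [← hJ.complex₀.so.orthogonal]
  have h2 : J₀ (i m) (-(J₀ (i m) * J₁ (i m)) (incl i m e)) = incl i m e' := by
    rw [Module.End.mul_apply, map_neg, apply_apply_of_sq (hJ.complex₀.sq _), neg_neg, he]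
  exact (congrArg (pairing · _) h2).trans (pairing_conormal e' h1)

/-- The invariant part is the kernel of J followed by the quotient by TM ⊕ T*X|_M, whose dimension
is dim E - dim F; the source has dimension dim E + dim F. -/
lemma finrank_invariantPart_le [FiniteDimensional ℝ E] [FiniteDimensional ℝ F]
    (hd : Function.Injective (dmap F E i m)) (J : EndField E X) :
    2 * Module.finrank ℝ F ≤ Module.finrank ℝ (invariantPart F i J m) := by
  let R := LinearMap.range (incl (F := F) (E := E) i m)
  let f := R.mkQ ∘ₗ J (i m) ∘ₗ incl (F := F) i m
  have hker : LinearMap.ker f = invariantPart F i J m := by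
    change LinearMap.ker (R.mkQ ∘ₗ (J (i m) ∘ₗ incl i m)) = _
    rw [LinearMap.ker_comp, Submodule.ker_mkQ]
    rfl
  have h1 := f.finrank_range_add_finrank_ker
  have h2 := R.finrank_quotient_add_finrank
  have h3 : Module.finrank ℝ R = Module.finrank ℝ (RT F E i m) :=
    LinearMap.finrank_range_of_inj (incl_injective hd)
  have h4 := Submodule.finrank_le (LinearMap.range f)
  have h5 : Module.finrank ℝ (RT F E i m) = Module.finrank ℝ F + Module.finrank ℝ E := by
    rw [Module.finrank_prod, finrank_cot]
    rfl
  rw [hker] at h1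
  rw [finrank_GT] at h2
  omega

/-- On the J₁-invariant part p is injective, and the dimension bound then makes it surjective. The
kernel condition holds trivially, as that part meets N* in zero. -/
lemma descends_of_kahler [FiniteDimensional ℝ E] [FiniteDimensional ℝ F]
    (hd : ∀ m, Function.Injective (dmap F E i m))
    (hJ : IsGeneralizedKahler J₀ J₁) (hN : ConormalInvariant F i J₀) : Descends F i J₁ where
  ker m e e' he hp := by
    have h0 := eq_zero_of_conormal (hd m) hJ hN he hp
    rw [h0, map_zero, map_zero] at he
    rw [incl_injective (hd m) (he.symm.trans (map_zero _).symm), map_zero]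
  surj m := by
    let f : invariantPart F i J₁ m →ₗ[ℝ] GT F m := (pmap i m) ∘ₗ Submodule.subtype _
    have hf : Function.Injective f := by
      rw [injective_iff_map_eq_zero]
      intro e he
      obtain ⟨e', h'⟩ := mem_invariantPart.1 e.2
      exact Subtype.ext (eq_zero_of_conormal (hd m) hJ hN h' he)
    have htop : LinearMap.range f = ⊤ := by
      refine Submodule.eq_top_of_finrank_eq (le_antisymm (Submodule.finrank_le _) ?_)
      rw [LinearMap.finrank_range_of_inj hf, finrank_GT]
      exact finrank_invariantPart_le (hd m) J₁
    intro ε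
    obtain ⟨e, he⟩ := LinearMap.range_eq_top.1 htop ε
    obtain ⟨e', h'⟩ := mem_invariantPart.1 e.2
    exact ⟨e, e', he, h'⟩

/-- `J` and `JM` are intertwined by the lifts `σ`. -/
def Intertwines (i : M → X) (σ : ∀ m : M, GT F m →ₗ[ℝ] RT F E i m) (J : EndField E X)
    (JM : EndField F M) : Prop :=
  ∀ (m : M) (ε : GT F m), J (i m) (incl i m (σ m ε)) = incl i m (σ m (JM m ε))

/-- Since p is injective on the J₁-invariant part, the lift is a two-sided inverse of p there. -/
lemma IsLift.apply_pmap {σ : ∀ m : M, GT F m →ₗ[ℝ] RT F E i m}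
    (hd : Function.Injective (dmap F E i m))
    (hJ : IsGeneralizedKahler J₀ J₁) (hN : ConormalInvariant F i J₀) (hσ : IsLift i J₁ σ)
    {e e' : RT F E i m} (he : J₁ (i m) (incl i m e) = incl i m e') : σ m (pmap i m e) = e := by
  obtain ⟨e'', he''⟩ := hσ.mem m (pmap i m e)
  have h := eq_zero_of_conormal hd hJ hN (e := e - σ m (pmap i m e)) (e' := e' - e'')
    (by rw [map_sub, map_sub, he, he'', map_sub]) (by rw [map_sub, hσ.pmap_apply, sub_self])
  exact (sub_eq_zero.1 h).symm

lemma intertwines₁ {σ : ∀ m : M, GT F m →ₗ[ℝ] RT F E i m}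
    (hd : ∀ m, Function.Injective (dmap F E i m))
    (hJ : IsGeneralizedKahler J₀ J₁) (hN : ConormalInvariant F i J₀) (hσ : IsLift i J₁ σ)
    {JM : EndField F M} (hJM : IsInduced i J₁ JM) : Intertwines i σ J₁ JM := by
  rw [isInduced_iff hJ.complex₁.sq] at hJM
  intro m ε
  obtain ⟨e', he'⟩ := hσ.mem m ε
  have h1 := hJM m _ _ he'
  rw [hσ.pmap_apply] at h1
  rw [h1, he', hσ.apply_pmap (hd m) hJ hN (e := e') (e' := -σ m ε)]
  rw [← he', apply_apply_of_sq (hJ.complex₁.sq _), map_neg]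

/-- The lifts are those of J₁, yet J₀ respects them: J₁ J₀ e = J₀ J₁ e stays in TM ⊕ T*X|_M, so J₀
preserves the J₁-invariant part. -/
lemma intertwines₀ [FiniteDimensional ℝ E] {σ : ∀ m : M, GT F m →ₗ[ℝ] RT F E i m}
    (hd : ∀ m, Function.Injective (dmap F E i m))
    (hJ : IsGeneralizedKahler J₀ J₁) (hN : ConormalInvariant F i J₀) (hσ : IsLift i J₁ σ)
    {JM : EndField F M} (hJM : IsInduced i J₀ JM) : Intertwines i σ J₀ JM := by
  rw [isInduced_iff hJ.complex₀.sq] at hJM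
  intro m ε
  obtain ⟨e', he'⟩ := exists_incl_of_conormalInvariant hJ.complex₀.so.orthogonal hN (σ m ε)
  obtain ⟨e₁, he₁⟩ := hσ.mem m ε
  obtain ⟨e₁', he₁'⟩ := exists_incl_of_conormalInvariant hJ.complex₀.so.orthogonal hN e₁
  have h1 := hJM m _ _ he'
  rw [hσ.pmap_apply] at h1
  rw [h1, he', hσ.apply_pmap (hd m) hJ hN (e := e') (e' := e₁')]
  rw [← he', ← he₁', ← he₁, ← Module.End.mul_apply, ← Module.End.mul_apply, hJ.comm]

lemma IsLift.injective {σ : ∀ m : M, GT F m →ₗ[ℝ] RT F E i m}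
    (hd : Function.Injective (dmap F E i m)) (hσ : IsLift i J σ) {ε ε' : GT F m}
    (h : incl i m (σ m ε) = incl i m (σ m ε')) : ε = ε' := by
  rw [← hσ.pmap_apply m ε, incl_injective hd h, hσ.pmap_apply]

lemma IsLift.pairing_eq {σ : ∀ m : M, GT F m →ₗ[ℝ] RT F E i m}
    (hσ : IsLift i J σ) (ε ε' : GT F m) :
    pairing (incl i m (σ m ε)) (incl i m (σ m ε')) = pairing ε ε' := by
  rw [pairing_incl, hσ.pmap_apply, hσ.pmap_apply]

end Pointwise

/-! ## Smoothness along a submanifold -/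

section Smooth

variable {E : Type*} [NormedAddCommGroup E] [NormedSpace ℝ E]
  {X : Type*} [TopologicalSpace X] [ChartedSpace E X] [IsManifold 𝓘(ℝ, E) ∞ X]
  {F : Type*} [NormedAddCommGroup F] [NormedSpace ℝ F]
  {M : Type*} [TopologicalSpace M] [ChartedSpace F M] [IsManifold 𝓘(ℝ, F) ∞ M]
  {i : M → X} {m₀ m : M}

/-- An immersion has a smooth left inverse, locally. -/
lemma exists_retraction (hi : Manifold.IsImmersion 𝓘(ℝ, F) 𝓘(ℝ, E) ∞ i) (m₀ : M) :
    ∃ (O : Set X) (U : Set M) (r : X → M), IsOpen O ∧ IsOpen U ∧ m₀ ∈ U ∧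
      ContMDiffOn 𝓘(ℝ, E) 𝓘(ℝ, F) ∞ r O ∧ ∀ m ∈ U, i m ∈ O ∧ r (i m) = m := by
  have h := hi.isImmersionAt m₀
  -- In the normal form u ↦ (u, 0) of an immersion, projection to the first factor is a left
  -- inverse.
  let L : E → F := fun y ↦ (h.equiv.symm y).1
  have hL : ContDiff ℝ ∞ L := contDiff_fst.comp h.equiv.symm.contDiff
  have hc := contMDiffOn_of_mem_maximalAtlas h.codChart_mem_maximalAtlas
  have hd := contMDiffOn_symm_of_mem_maximalAtlas h.domChart_mem_maximalAtlas
  have hLc : ContMDiffOn 𝓘(ℝ, E) 𝓘(ℝ, F) ∞ (fun x ↦ L (h.codChart x)) h.codChart.source :=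
    hL.contMDiff.comp_contMDiffOn hc
  have key : ∀ m ∈ h.domChart.source, L (h.codChart (i m)) = h.domChart m := by
    intro m hm
    have h1 := h.writtenInCharts (show h.domChart m ∈ (h.domChart.extend 𝓘(ℝ, F)).target by
      simpa using h.domChart.map_source hm)
    have h2 : h.codChart (i m) = h.equiv (h.domChart m, 0) := by
      simpa [h.domChart.left_inv hm] using h1
    simp [L, h2]
  refine ⟨h.codChart.source ∩ (fun x ↦ L (h.codChart x)) ⁻¹' h.domChart.target,
    h.domChart.source, fun x ↦ h.domChart.symm (L (h.codChart x)),
    hLc.continuousOn.isOpen_inter_preimage h.codChart.open_source h.domChart.open_target,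
    h.domChart.open_source, h.mem_domChart_source, ?_, fun m hm ↦ ⟨⟨?_, ?_⟩, ?_⟩⟩
  · exact hd.comp (hLc.mono Set.inter_subset_left) fun x hx ↦ hx.2
  · exact h.source_subset_preimage_source hm
  · rw [Set.mem_preimage, key m hm]
    exact h.domChart.map_source hm
  · change h.domChart.symm (L (h.codChart (i m))) = m
    rw [key m hm, h.domChart.left_inv hm]

/-- Chain rule applied to r ∘ i = id for a local retraction r. -/
lemma dmap_injective (hi : Manifold.IsImmersion 𝓘(ℝ, F) 𝓘(ℝ, E) ∞ i) (m : M) :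
    Function.Injective (dmap F E i m) := by
  obtain ⟨O, U, r, hO, hU, hm, hr, hri⟩ := exists_retraction hi m
  have h1 : MDifferentiableAt 𝓘(ℝ, E) 𝓘(ℝ, F) r (i m) :=
    (hr.contMDiffAt (hO.mem_nhds (hri m hm).1)).mdifferentiableAt (by simp)
  have h2 : MDifferentiableAt 𝓘(ℝ, F) 𝓘(ℝ, E) i m := hi.contMDiff.mdifferentiable (by simp) m
  have h3 : r ∘ i =ᶠ[𝓝 m] id := by
    filter_upwards [hU.mem_nhds hm] with m' hm'
    exact (hri m' hm').2
  have h4 := (h1.hasMFDerivAt.comp m h2.hasMFDerivAt).mfderiv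
  rw [h3.mfderiv_eq, mfderiv_id] at h4
  intro u v huv
  have h5 (w : Tan F m) : mfderiv 𝓘(ℝ, E) 𝓘(ℝ, F) r (i m) (dmap F E i m w) = w :=
    (congrArg (fun T ↦ T w) h4).symm
  rw [← h5 u, huv, h5]

lemma dCoord_injective (hd : Function.Injective (dmap F E i m)) (hm : m ∈ chartDom F E i m₀) :
    Function.Injective (dCoord F E i m₀ m) := by
  intro u v huv
  have h1 : dmap F E i m (tanFrame m₀ m u) = dmap F E i m (tanFrame m₀ m v) := by
    rw [← tanFrame_tanCoord hm.2 (dmap F E i m (tanFrame m₀ m u)),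
      ← tanFrame_tanCoord hm.2 (dmap F E i m (tanFrame m₀ m v))]
    exact congrArg _ huv
  rw [← tanCoord_tanFrame hm.1 u, hd h1, tanCoord_tanFrame hm.1]

/-! ### Maps between sections, in coordinates -/

/-- The inclusion `TM ⊕ T*X|_M → (TX ⊕ T*X)|_M` in coordinates. -/
def inclCoord (D : F →L[ℝ] E) : F × (E →L[ℝ] ℝ) →L[ℝ] E × (E →L[ℝ] ℝ) :=
  D.prodMap (ContinuousLinearMap.id ℝ _)

/-- The map `p` in coordinates. -/
def pmapCoord (D : F →L[ℝ] E) : F × (E →L[ℝ] ℝ) →L[ℝ] F × (F →L[ℝ] ℝ) :=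
  (ContinuousLinearMap.id ℝ _).prodMap ((ContinuousLinearMap.compL ℝ F E ℝ).flip D)

lemma inclCoord_apply (D : F →L[ℝ] E) (e : F × (E →L[ℝ] ℝ)) : inclCoord D e = (D e.1, e.2) := rfl

lemma pmapCoord_apply (D : F →L[ℝ] E) (e : F × (E →L[ℝ] ℝ)) :
    pmapCoord D e = (e.1, e.2.comp D) := rfl

lemma gtCoord_incl (hm : m ∈ chartDom F E i m₀) (e : RT F E i m) :
    gtCoord (i m₀) (i m) (incl i m e) = inclCoord (dCoord F E i m₀ m) (rtCoord i m₀ m e) := by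
  rw [gtCoord_apply, incl_apply, tanCoord_dmap hm]
  rfl

lemma gtCoord_pmap (hm : m ∈ chartDom F E i m₀) (e : RT F E i m) :
    gtCoord m₀ m (pmap i m e) = pmapCoord (dCoord F E i m₀ m) (rtCoord i m₀ m e) := by
  rw [gtCoord_apply, pmap_apply, cotCoord_pullCot hm]
  rfl

lemma rtCoord_injective (hm : m ∈ chartDom F E i m₀) :
    Function.Injective (rtCoord (F := F) (E := E) i m₀ m) :=
  Function.LeftInverse.injective (g := rtFrame i m₀ m) (rtFrame_rtCoord hm)

lemma gtCoord_injective {x₀ x : X} (hx : x ∈ (chartAt E x₀).source) :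
    Function.Injective (gtCoord (E := E) x₀ x) :=
  Function.LeftInverse.injective (g := gtFrame x₀ x) (gtFrame_gtCoord hx)

lemma contMDiffOn_inclCoord [FiniteDimensional ℝ E] [FiniteDimensional ℝ F] {U : Set M}
    {D : M → F →L[ℝ] E} (hD : ContMDiffOn 𝓘(ℝ, F) 𝓘(ℝ, F →L[ℝ] E) ∞ D U) :
    ContMDiffOn 𝓘(ℝ, F) 𝓘(ℝ, F × (E →L[ℝ] ℝ) →L[ℝ] E × (E →L[ℝ] ℝ)) ∞
      (fun m ↦ inclCoord (D m)) U :=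
  contMDiffOn_clm_of_apply fun _ ↦ (hD.clm_apply contMDiffOn_const).prodMk_space contMDiffOn_const

lemma contMDiffOn_pmapCoord [FiniteDimensional ℝ E] [FiniteDimensional ℝ F] {U : Set M}
    {D : M → F →L[ℝ] E} (hD : ContMDiffOn 𝓘(ℝ, F) 𝓘(ℝ, F →L[ℝ] E) ∞ D U) :
    ContMDiffOn 𝓘(ℝ, F) 𝓘(ℝ, F × (E →L[ℝ] ℝ) →L[ℝ] F × (F →L[ℝ] ℝ)) ∞
      (fun m ↦ pmapCoord (D m)) U :=
  contMDiffOn_clm_of_apply fun _ ↦ contMDiffOn_const.prodMk_space (contMDiffOn_const.clm_comp hD)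

lemma SmoothRT.mono {U V : Set M} {s : ∀ m, RT F E i m} (hs : SmoothRT i U s) (h : V ⊆ U) :
    SmoothRT i V s := ⟨ContMDiffOn.mono hs.1 h, ContMDiffOn.mono hs.2 h⟩

lemma smoothRT_of_locally {U : Set M} {s : ∀ m, RT F E i m}
    (h : ∀ m ∈ U, ∃ V, IsOpen V ∧ m ∈ V ∧ SmoothRT i (U ∩ V) s) : SmoothRT i U s := by
  constructor
  · refine contMDiffOn_of_locally_contMDiffOn fun x hx ↦ ?_
    obtain ⟨V, h1, h2, h3⟩ := h x hx
    exact ⟨V, h1, h2, h3.1⟩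
  · refine contMDiffOn_of_locally_contMDiffOn fun x hx ↦ ?_
    obtain ⟨V, h1, h2, h3⟩ := h x hx
    exact ⟨V, h1, h2, h3.2⟩

lemma SmoothRT.pmap [FiniteDimensional ℝ E] [FiniteDimensional ℝ F]
    (hi : ContMDiff 𝓘(ℝ, F) 𝓘(ℝ, E) ∞ i) {U : Set M} {s : ∀ m, RT F E i m}
    (hs : SmoothRT i U s) : SmoothGT U (fun m ↦ pmap i m (s m)) := by
  refine smoothGT_of_locally fun m₀ _ ↦
    ⟨chartDom F E i m₀, isOpen_chartDom hi.continuous m₀, mem_chartDom i m₀, ?_⟩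
  rw [smoothGT_iff_coord (x₀ := m₀) fun m hm ↦ hm.2.1]
  have h1 := (smoothRT_iff_coord hi (m₀ := m₀) Set.inter_subset_right s).1
    (hs.mono (Set.inter_subset_left (t := chartDom F E i m₀)))
  exact ((contMDiffOn_pmapCoord ((contMDiffOn_dCoord hi m₀).mono Set.inter_subset_right)).clm_apply
    h1).congr fun m hm ↦ gtCoord_pmap hm.2 _

/-- Local smoothness of the image of `e` under `J`, when it is a section of `TM ⊕ T*X|_M`. -/
lemma SmoothRT.apply [FiniteDimensional ℝ E] [FiniteDimensional ℝ F]
    (hi : ContMDiff 𝓘(ℝ, F) 𝓘(ℝ, E) ∞ i) (hd : ∀ m, Function.Injective (dmap F E i m))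
    {J : EndField E X} (hJ : IsSOSection J) {U : Set M}
    {s t : ∀ m, RT F E i m} (hs : SmoothRT i U s)
    (hst : ∀ m ∈ U, J (i m) (incl i m (s m)) = incl i m (t m)) : SmoothRT i U t := by
  refine smoothRT_of_locally fun m₀ hm₀ ↦ ?_
  obtain ⟨V, hVU, hV, hm₀V, R, hR, hRD⟩ := exists_smooth_leftInverse
    (isOpen_chartDom hi.continuous m₀) (contMDiffOn_dCoord hi m₀) (mem_chartDom i m₀)
    (dCoord_injective (hd m₀) (mem_chartDom i m₀))
  refine ⟨V, hV, hm₀V, ?_⟩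
  have hUV : U ∩ V ⊆ chartDom F E i m₀ := fun m hm ↦ hVU hm.2
  rw [smoothRT_iff_coord hi hUV]
  have h1 := (smoothRT_iff_coord hi hUV s).1 (hs.mono Set.inter_subset_left)
  have h2 := (contMDiffOn_inclCoord ((contMDiffOn_dCoord hi m₀).mono hUV)).clm_apply h1
  have h3 := (((contMDiffOn_endCoord hJ.smooth (i m₀)).comp hi.contMDiffOn
    fun m hm ↦ (hUV hm).2).clm_apply h2)
  have h4 : ContMDiffOn 𝓘(ℝ, F) 𝓘(ℝ, E × (E →L[ℝ] ℝ)) ∞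
      (fun m ↦ inclCoord (dCoord F E i m₀ m) (rtCoord i m₀ m (t m))) (U ∩ V) := by
    refine h3.congr fun m hm ↦ ?_
    rw [← gtCoord_incl (hUV hm), ← hst m hm.1, Function.comp_apply, ← gtCoord_incl (hUV hm),
      endCoord_gtCoord J (hUV hm).2]
  rw [contMDiffOn_prod_module_iff] at h4 ⊢
  -- The tangent part of t is so far known to be smooth only after the differential of i; the smooth
  -- left inverse R removes it.
  refine ⟨((hR.mono Set.inter_subset_right).clm_apply h4.1).congr fun m hm ↦ ?_, h4.2⟩
  exact (hRD m hm.2 _).symm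

/-- A section of `TM ⊕ T*X|_M` extends to a section of `TX ⊕ T*X`, locally. -/
lemma exists_extension [FiniteDimensional ℝ E] [FiniteDimensional ℝ F]
    (hi : Manifold.IsImmersion 𝓘(ℝ, F) 𝓘(ℝ, E) ∞ i)
    {U : Set M} (hU : IsOpen U) {m₀ : M} (hm₀ : m₀ ∈ U) :
    ∃ (O : Set X) (V : Set M), IsOpen O ∧ IsOpen V ∧ m₀ ∈ V ∧ V ⊆ U ∧ (∀ m ∈ V, i m ∈ O) ∧
      ∀ s : ∀ m, RT F E i m, SmoothRT i U s → ∃ t : ∀ x, GT E x, SmoothGT O t ∧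
        ∀ m ∈ V, t (i m) = incl i m (s m) := by
  obtain ⟨O, W, r, hO, hW, hmW, hr, hri⟩ := exists_retraction hi m₀
  have hi' := hi.contMDiff
  have hUC : IsOpen (U ∩ chartDom F E i m₀) := hU.inter (isOpen_chartDom hi'.continuous m₀)
  let O' : Set X := (O ∩ r ⁻¹' (U ∩ chartDom F E i m₀)) ∩ (chartAt E (i m₀)).source
  refine ⟨O', W ∩ (U ∩ chartDom F E i m₀), (hr.continuousOn.isOpen_inter_preimage hO hUC).inter
    (chartAt E (i m₀)).open_source, hW.inter hUC, ⟨hmW, hm₀, mem_chartDom i m₀⟩,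
    fun m hm ↦ hm.2.1, fun m hm ↦ ⟨⟨(hri m hm.1).1, ?_⟩, hm.2.2.2⟩, fun s hs ↦ ?_⟩
  · rw [Set.mem_preimage, (hri m hm.1).2]
    exact hm.2
  -- The value at i(r x) is carried to x with unchanged coordinates in the chart at i m₀, so the
  -- extension is constant along the fibres of r.
  refine ⟨fun x ↦ gtFrame (i m₀) x
    (gtCoord (i m₀) (i (r x)) (incl i (r x) (s (r x)))), ?_, fun m hm ↦ ?_⟩
  · rw [smoothGT_iff_coord (x₀ := i m₀) Set.inter_subset_right]
    have h1 := (smoothRT_iff_coord hi' (m₀ := m₀) Set.inter_subset_right s).1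
      (hs.mono (Set.inter_subset_left (t := chartDom F E i m₀)))
    have h2 := (contMDiffOn_inclCoord ((contMDiffOn_dCoord hi' m₀).mono
      (Set.inter_subset_right (s := U)))).clm_apply h1
    refine (h2.comp (hr.mono fun x (hx : x ∈ O') ↦ hx.1.1) fun x hx ↦ hx.1.2).congr
      fun x hx ↦ ?_
    rw [gtCoord_gtFrame hx.2, gtCoord_incl hx.1.2.2]
    rfl
  · change gtFrame (i m₀) (i m) (gtCoord (i m₀) (i (r (i m)))
      (incl i (r (i m)) (s (r (i m))))) = _
    rw [(hri m hm.1).2, gtFrame_gtCoord hm.2.2.2]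

/-- The lift of a smooth section of `TM ⊕ T*M` to the `J`-invariant part of `TM ⊕ T*X|_M` is
smooth, if this lift is unique. -/
lemma IsLift.exists_smooth [FiniteDimensional ℝ E] [FiniteDimensional ℝ F]
    (hi : ContMDiff 𝓘(ℝ, F) 𝓘(ℝ, E) ∞ i) (hd : ∀ m, Function.Injective (dmap F E i m))
    {J : EndField E X} (hJ : IsSOSection J) {σ : ∀ m : M, GT F m →ₗ[ℝ] RT F E i m}
    (hσ : IsLift i J σ)
    (hK : ∀ (m : M) (e e' : RT F E i m), J (i m) (incl i m e) = incl i m e' → pmap i m e = 0 →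
      e = 0) (m₀ : M) :
    ∃ V ⊆ chartDom F E i m₀, IsOpen V ∧ m₀ ∈ V ∧
      ∃ B : M → (F × (F →L[ℝ] ℝ)) →L[ℝ] (F × (E →L[ℝ] ℝ)),
        ContMDiffOn 𝓘(ℝ, F) 𝓘(ℝ, (F × (F →L[ℝ] ℝ)) →L[ℝ] (F × (E →L[ℝ] ℝ))) ∞ B V ∧
        ∀ m ∈ V, ∀ ε, rtCoord i m₀ m (σ m ε) = B m (gtCoord m₀ m ε) := by
  let D := dCoord F E i m₀
  have hD : ContMDiffOn 𝓘(ℝ, F) 𝓘(ℝ, F →L[ℝ] E) ∞ D (chartDom F E i m₀) := contMDiffOn_dCoord hi m₀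
  let C : M → (E × (E →L[ℝ] ℝ)) →L[ℝ] (E × (E →L[ℝ] ℝ)) := fun m ↦ endCoord J (i m₀) (i m)
  have hC : ContMDiffOn 𝓘(ℝ, F) 𝓘(ℝ, (E × (E →L[ℝ] ℝ)) →L[ℝ] (E × (E →L[ℝ] ℝ))) ∞ C
      (chartDom F E i m₀) :=
    (contMDiffOn_endCoord hJ.smooth (i m₀)).comp hi.contMDiffOn fun m hm ↦ hm.2
  let P : ((F × (E →L[ℝ] ℝ)) × F) →L[ℝ] F × (E →L[ℝ] ℝ) := ContinuousLinearMap.fst ℝ _ _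
  -- The lift e of ε solves p e = ε and (J e)₁ = D w, where the extra unknown w in F witnesses that
  -- J e is tangent to M. Thus Φ(e, w) = (ε, 0), and a smooth left inverse of Φ recovers e.
  let Φ : M → ((F × (E →L[ℝ] ℝ)) × F) →L[ℝ] ((F × (F →L[ℝ] ℝ)) × E) := fun m ↦
    (pmapCoord (D m) ∘L P).prod
      (ContinuousLinearMap.fst ℝ _ _ ∘L C m ∘L inclCoord (D m) ∘L P -
        D m ∘L ContinuousLinearMap.snd ℝ _ _)
  have hΦ_apply (m a) : Φ m a = (pmapCoord (D m) a.1, (C m (inclCoord (D m) a.1)).1 - D m a.2) :=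
    rfl
  have hΦ : ContMDiffOn 𝓘(ℝ, F) 𝓘(ℝ, ((F × (E →L[ℝ] ℝ)) × F) →L[ℝ] ((F × (F →L[ℝ] ℝ)) × E)) ∞
      Φ (chartDom F E i m₀) := by
    refine contMDiffOn_clm_of_apply fun a ↦ ?_
    have h1 := hC.clm_apply ((contMDiffOn_inclCoord hD).clm_apply (contMDiffOn_const (c := a.1)))
    rw [contMDiffOn_prod_module_iff] at h1
    exact ((contMDiffOn_pmapCoord hD).clm_apply contMDiffOn_const).prodMk_space
      (h1.1.sub (hD.clm_apply contMDiffOn_const))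
  -- A kernel element is a vector of ker p in the invariant part, zero by `hK`; then D w = 0 forces
  -- w = 0.
  have hinj : Function.Injective (Φ m₀) := by
    rw [injective_iff_map_eq_zero]
    intro a ha
    have hm₀ := mem_chartDom (F := F) (E := E) i m₀
    rw [hΦ_apply, Prod.mk_eq_zero] at ha
    have he := rtCoord_rtFrame hm₀ a.1
    have hw := tanCoord_tanFrame hm₀.1 a.2
    have h1 : pmap i m₀ (rtFrame i m₀ m₀ a.1) = 0 := by
      refine gtCoord_injective hm₀.1 ?_
      rw [gtCoord_pmap hm₀, he, map_zero]
      exact ha.1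
    have h2 : (J (i m₀) (incl i m₀ (rtFrame i m₀ m₀ a.1))).1 =
        dmap F E i m₀ (tanFrame m₀ m₀ a.2) := by
      rw [← tanFrame_tanCoord hm₀.2 (dmap F E i m₀ (tanFrame m₀ m₀ a.2)), tanCoord_dmap hm₀, hw,
        ← sub_eq_zero.1 ha.2]
      change _ = tanFrame (i m₀) (i m₀) (endCoord J (i m₀) (i m₀) _).1
      rw [← he, ← gtCoord_incl hm₀, endCoord_gtCoord J hm₀.2, gtCoord_apply,
        tanFrame_tanCoord hm₀.2, he]
    have h3 : rtFrame i m₀ m₀ a.1 = 0 :=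
      hK m₀ _ (tanFrame m₀ m₀ a.2, (J (i m₀) (incl i m₀ (rtFrame i m₀ m₀ a.1))).2)
        (Prod.ext h2 rfl) h1
    have h4 : a.1 = 0 := by rw [← he, h3, map_zero]
    refine Prod.ext h4 (dCoord_injective (hd m₀) hm₀ ?_)
    have h5 := ha.2
    rw [h4, map_zero, map_zero, Prod.fst_zero, zero_sub, neg_eq_zero] at h5
    exact h5.trans (map_zero _).symm
  obtain ⟨V, hVU, hV, hm₀V, Ψ, hΨ, hΨΦ⟩ := exists_smooth_leftInverse
    (isOpen_chartDom hi.continuous m₀) hΦ (mem_chartDom i m₀) hinj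
  refine ⟨V, hVU, hV, hm₀V, fun m ↦ P ∘L Ψ m ∘L ContinuousLinearMap.inl ℝ _ _, ?_, ?_⟩
  · exact contMDiffOn_const.clm_comp (hΨ.clm_comp contMDiffOn_const)
  · intro m hm ε
    obtain ⟨e', he'⟩ := hσ.mem m ε
    have h1 : Φ m (rtCoord i m₀ m (σ m ε), tanCoord m₀ m e'.1) = (gtCoord m₀ m ε, 0) := by
      rw [hΦ_apply, ← gtCoord_pmap (hVU hm), hσ.pmap_apply, ← gtCoord_incl (hVU hm),
        endCoord_gtCoord J (hVU hm).2, he', gtCoord_incl (hVU hm), inclCoord_apply, rtCoord_apply,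
        sub_self]
    change _ = (Ψ m (gtCoord m₀ m ε, 0)).1
    rw [← h1, hΨΦ m hm]

lemma IsLift.smoothRT [FiniteDimensional ℝ E] [FiniteDimensional ℝ F]
    (hi : ContMDiff 𝓘(ℝ, F) 𝓘(ℝ, E) ∞ i) (hd : ∀ m, Function.Injective (dmap F E i m))
    {J : EndField E X} (hJ : IsSOSection J) {σ : ∀ m : M, GT F m →ₗ[ℝ] RT F E i m}
    (hσ : IsLift i J σ)
    (hK : ∀ (m : M) (e e' : RT F E i m), J (i m) (incl i m e) = incl i m e' → pmap i m e = 0 →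
      e = 0) {U : Set M} {s : ∀ m, GT F m} (hs : SmoothGT U s) :
    SmoothRT i U (fun m ↦ σ m (s m)) := by
  refine smoothRT_of_locally fun m₀ _ ↦ ?_
  obtain ⟨V, hVU, hV, hm₀V, B, hB, hσB⟩ := hσ.exists_smooth hi hd hJ hK m₀
  refine ⟨V, hV, hm₀V, ?_⟩
  rw [smoothRT_iff_coord hi (m₀ := m₀) fun m hm ↦ hVU hm.2]
  have h1 := (smoothGT_iff_coord (x₀ := m₀) (U := U ∩ V) (fun m hm ↦ (hVU hm.2).1) s).1
    (hs.mono Set.inter_subset_left)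
  exact ((hB.mono Set.inter_subset_right).clm_apply h1).congr fun m hm ↦ hσB m hm.2 _

end Smooth

/-! ## Subbundles -/

section Subbundles

variable {E : Type*} [NormedAddCommGroup E] [NormedSpace ℝ E] [FiniteDimensional ℝ E]
  {X : Type*} [TopologicalSpace X] [ChartedSpace E X] [IsManifold 𝓘(ℝ, E) ∞ X]
  {F : Type*} [NormedAddCommGroup F] [NormedSpace ℝ F] [FiniteDimensional ℝ F]
  {M : Type*} [TopologicalSpace M] [ChartedSpace F M] [IsManifold 𝓘(ℝ, F) ∞ M]
  {i : M → X} {J J₀ J₁ : EndField E X}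

/-- The `(-√-1)`-eigenspaces of `J` in a family `Q` of `J`-invariant real subspaces of constant
rank, locally spanned by smooth sections, are a smooth subbundle. -/
lemma isSubbundle_of_spanning {A : Type*} [NormedAddCommGroup A] [NormedSpace ℝ A]
    (hi : ContMDiff 𝓘(ℝ, F) 𝓘(ℝ, E) ∞ i) (hd : ∀ m, Function.Injective (dmap F E i m))
    (hJ : IsSOSection J) (hJ2 : ∀ x, J x * J x = -1)
    {S : ∀ m : M, Submodule ℂ (ℂ ⊗[ℝ] RT F E i m)} {Q : ∀ m : M, Submodule ℝ (RT F E i m)}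
    (hS : ∀ m a b, cplx a b ∈ S m ↔ a ∈ Q m ∧ J (i m) (incl i m a) = incl i m b)
    (hQ : ∀ m, ∀ a ∈ Q m, ∃ b ∈ Q m, J (i m) (incl i m a) = incl i m b)
    (hrank : ∀ m m', Module.finrank ℝ (Q m) = Module.finrank ℝ (Q m'))
    (hB : ∀ m₀, ∃ V ⊆ chartDom F E i m₀, IsOpen V ∧ m₀ ∈ V ∧
      ∃ B : M → A →L[ℝ] (F × (E →L[ℝ] ℝ)),
        ContMDiffOn 𝓘(ℝ, F) 𝓘(ℝ, A →L[ℝ] (F × (E →L[ℝ] ℝ))) ∞ B V ∧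
        ∀ m ∈ V, ∀ e, e ∈ Q m ↔ ∃ α, B m α = rtCoord i m₀ m e) :
    IsSubbundle i S := by
  intro m₀
  obtain ⟨V, hVU, hV, hm₀, B, hBV, hBQ⟩ := hB m₀
  have hmem {m} (hm : m ∈ V) (α : A) : rtFrame i m₀ m (B m α) ∈ Q m :=
    (hBQ m hm _).2 ⟨α, (rtCoord_rtFrame (hVU hm) _).symm⟩
  let B₀ : A →ₗ[ℝ] GT E (i m₀) := incl i m₀ ∘ₗ rtFrame i m₀ m₀ ∘ₗ (B m₀).toLinearMap
  have hB₀ : LinearMap.range B₀ = (Q m₀).map (incl i m₀) := by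
    ext v
    constructor
    · rintro ⟨α, rfl⟩
      exact ⟨_, hmem hm₀ α, rfl⟩
    · rintro ⟨e, he, rfl⟩
      obtain ⟨α, hα⟩ := (hBQ m₀ hm₀ e).1 he
      refine ⟨α, ?_⟩
      change incl i m₀ (rtFrame i m₀ m₀ (B m₀ α)) = _
      rw [hα, rtFrame_rtCoord (hVU hm₀)]
  -- The parameters α are chosen at m₀ and then kept constant; the frame at m is a_j = B m (α j),
  -- b_j = J a_j.
  obtain ⟨k, α, hli, hk⟩ := exists_complex_frame (hJ2 (i m₀)) B₀ fun β ↦ by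
    obtain ⟨b, hb, h⟩ := hQ m₀ _ (hmem hm₀ β)
    rw [hB₀]
    exact ⟨b, hb, h.symm⟩
  rw [hB₀, ← (Submodule.equivMapOfInjective _ (incl_injective (hd m₀)) (Q m₀)).finrank_eq] at hk
  choose g hg using fun m ↦ (incl (F := F) (E := E) i m).exists_leftInverse_of_injective
    (LinearMap.ker_eq_bot.2 (incl_injective (hd m)))
  let a : Fin k → ∀ m, RT F E i m := fun j m ↦ rtFrame i m₀ m (B m (α j))
  let b : Fin k → ∀ m, RT F E i m := fun j m ↦ g m (J (i m) (incl i m (a j m)))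
  have hab {m} (hm : m ∈ V) (j) : b j m ∈ Q m ∧ J (i m) (incl i m (a j m)) = incl i m (b j m) := by
    obtain ⟨b', hb', h⟩ := hQ m _ (hmem hm (α j))
    have h1 : b j m = b' := by
      change g m (J (i m) (incl i m (rtFrame i m₀ m (B m (α j))))) = b'
      rw [h]
      exact LinearMap.congr_fun (hg m) b'
    rw [h1]
    exact ⟨hb', h⟩
  have ha_smooth (j) : SmoothRT i V (a j) :=
    (smoothRT_iff_coord hi hVU _).2 ((hBV.clm_apply contMDiffOn_const).congr fun m hm ↦
      rtCoord_rtFrame (hVU hm) _)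
  have hb_smooth (j) : SmoothRT i V (b j) :=
    (ha_smooth j).apply hi hd hJ fun m hm ↦ (hab hm j).2
  let c : M → Fin k ⊕ Fin k → F × (E →L[ℝ] ℝ) := fun m ↦
    rtCoord i m₀ m ∘ Sum.elim (fun j ↦ a j m) (fun j ↦ b j m)
  have hc : ContinuousOn c V := by
    refine continuousOn_pi.2 ?_
    rintro (j | j)
    · exact ((smoothRT_iff_coord hi hVU _).1 (ha_smooth j)).continuousOn
    · exact ((smoothRT_iff_coord hi hVU _).1 (hb_smooth j)).continuousOn
  have hc₀ : LinearIndependent ℝ (c m₀) := by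
    refine LinearIndependent.map' ?_ _ (LinearMap.ker_eq_bot.2 (rtCoord_injective (hVU hm₀)))
    refine LinearIndependent.of_comp (incl i m₀) ?_
    have hfun : ⇑(incl i m₀) ∘ Sum.elim (fun j ↦ a j m₀) (fun j ↦ b j m₀) =
        Sum.elim (fun j ↦ B₀ (α j)) (fun j ↦ J (i m₀) (B₀ (α j))) := by
      funext j
      rcases j with j | j
      · rfl
      · exact (hab hm₀ j).2.symm
    rw [hfun]
    exact hli
  -- Linear independence is an open condition on the coordinates, so the frame at m₀ stays
  -- independent nearby; constancy of the rank makes it span Q m.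
  refine ⟨V ∩ c ⁻¹' {f | LinearIndependent ℝ f},
    hc.isOpen_inter_preimage hV isOpen_setOfPred_linearIndependent, ⟨hm₀, hc₀⟩, k, a, b,
    fun j ↦ (ha_smooth j).mono Set.inter_subset_left,
    fun j ↦ (hb_smooth j).mono Set.inter_subset_left, ?_⟩
  rintro m ⟨hm, hcm⟩
  have hlim : LinearIndependent ℝ (Sum.elim (fun j ↦ a j m) (fun j ↦ b j m)) :=
    LinearIndependent.of_comp (rtCoord i m₀ m) hcm
  have hspan : Submodule.span ℝ (Set.range (Sum.elim (fun j ↦ a j m) (fun j ↦ b j m))) = Q m := by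
    refine Submodule.eq_of_le_of_finrank_eq (Submodule.span_le.2 ?_) ?_
    · rintro _ ⟨j | j, rfl⟩
      · exact hmem hm _
      · exact (hab hm j).1
    · rw [finrank_span_eq_card hlim, Fintype.card_sum, Fintype.card_fin, hrank m m₀, ← hk, two_mul]
  refine ⟨linearIndependent_cplx hlim, le_antisymm (Submodule.span_le.2 ?_) fun z hz ↦ ?_⟩
  · rintro _ ⟨j, rfl⟩
    exact (hS m _ _).2 ⟨hmem hm _, (hab hm j).2⟩
  · obtain ⟨e, e', rfl⟩ := exists_cplx z
    obtain ⟨he, hee'⟩ := (hS m _ _).1 hz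
    rw [← hspan] at he
    obtain ⟨f, hf, hf'⟩ := exists_cplx_mem_span (hJ2 (i m)) (fun j ↦ (hab hm j).2) he
    rwa [incl_injective (hd m) (hee'.symm.trans hf)]

lemma finrank_conormal (hd : ∀ m, Function.Injective (dmap F E i m)) (m : M) :
    Module.finrank ℝ (LinearMap.ker (pmap (F := F) (E := E) i m)) =
      Module.finrank ℝ E - Module.finrank ℝ F := by
  have h1 := (pmap (F := F) (E := E) i m).finrank_range_add_finrank_ker
  have h2 : LinearMap.range (pmap (F := F) (E := E) i m) = ⊤ := by
    rw [LinearMap.range_eq_top]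
    intro ε
    obtain ⟨ξ, hξ⟩ := pullCot_surjective (hd m) ε.2
    exact ⟨(ε.1, ξ), by rw [pmap_apply, hξ]⟩
  have h3 : Module.finrank ℝ (RT F E i m) = Module.finrank ℝ F + Module.finrank ℝ E := by
    rw [Module.finrank_prod, finrank_cot]
    rfl
  rw [h2, finrank_top, finrank_GT, h3] at h1
  omega

/-- `L_J(M)` is a subbundle if `J` preserves `TM ⊕ T*X|_M`. -/
lemma isSubbundle_LM_of_invariant (hi : ContMDiff 𝓘(ℝ, F) 𝓘(ℝ, E) ∞ i)
    (hd : ∀ m, Function.Injective (dmap F E i m)) (hJ : IsSOSection J)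
    (hJ2 : ∀ x, J x * J x = -1)
    (h : ∀ (m : M) (e : RT F E i m), ∃ e' : RT F E i m, J (i m) (incl i m e) = incl i m e') :
    IsSubbundle i (LM F i J) := by
  refine isSubbundle_of_spanning (A := F × (E →L[ℝ] ℝ)) (Q := fun _ ↦ ⊤) hi hd hJ hJ2
    (fun m a b ↦ by simp [cplx_mem_LM hJ2]) (fun m a _ ↦ ?_) (fun m m' ↦ ?_) fun m₀ ↦ ?_
  · obtain ⟨b, hb⟩ := h m a
    exact ⟨b, trivial, hb⟩
  · rw [finrank_top, finrank_top, Module.finrank_prod, Module.finrank_prod, finrank_cot,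
      finrank_cot]
    rfl
  · exact ⟨_, subset_rfl, isOpen_chartDom hi.continuous m₀, mem_chartDom i m₀,
      fun _ ↦ ContinuousLinearMap.id ℝ _, contMDiffOn_const, fun m _ e ↦
      ⟨fun _ ↦ ⟨_, rfl⟩, fun _ ↦ trivial⟩⟩

/-- `L_J(N*)` is a subbundle if `J` preserves `N*`. -/
lemma isSubbundle_LN_of_invariant (hi : ContMDiff 𝓘(ℝ, F) 𝓘(ℝ, E) ∞ i)
    (hd : ∀ m, Function.Injective (dmap F E i m)) (hJ : IsSOSection J)
    (hJ2 : ∀ x, J x * J x = -1) (hJM : Descends F i J)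
    (h : ∀ (m : M) (e : RT F E i m), ∃ e' : RT F E i m, J (i m) (incl i m e) = incl i m e') :
    IsSubbundle i (LN F i J) := by
  refine isSubbundle_of_spanning (A := E →L[ℝ] ℝ) (Q := fun m ↦ LinearMap.ker (pmap i m))
    hi hd hJ hJ2 (fun m a b ↦ ?_) (fun m a ha ↦ ?_)
    (fun m m' ↦ by rw [finrank_conormal hd, finrank_conormal hd]) fun m₀ ↦ ?_
  · rw [cplx_mem_LN (hd m) hJ2, LinearMap.mem_ker, and_comm]
    exact ⟨fun h ↦ ⟨h.1.1, h.2⟩, fun h ↦ ⟨⟨h.1, hJM.ker m a b h.2 h.1⟩, h.2⟩⟩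
  · obtain ⟨b, hb⟩ := h m a
    exact ⟨b, hJM.ker m a b hb ha, hb⟩
  · obtain ⟨V, hVU, hV, hm₀V, R, hR, hRD⟩ := exists_smooth_leftInverse
      (isOpen_chartDom hi.continuous m₀) (contMDiffOn_dCoord hi m₀) (mem_chartDom i m₀)
      (dCoord_injective (hd m₀) (mem_chartDom i m₀))
    -- P = 1 - D R kills the image of D, and ξ ∘ P = ξ for every ξ vanishing there, so the covectors
    -- ξ ∘ P are exactly the conormal ones.
    let P : M → E →L[ℝ] E := fun m ↦ ContinuousLinearMap.id ℝ E - dCoord F E i m₀ m ∘L R m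
    have hP : ContMDiffOn 𝓘(ℝ, F) 𝓘(ℝ, E →L[ℝ] E) ∞ P V :=
      contMDiffOn_const.sub (((contMDiffOn_dCoord hi m₀).mono hVU).clm_comp hR)
    refine ⟨V, hVU, hV, hm₀V, fun m ↦ ContinuousLinearMap.inr ℝ _ _ ∘L
      (ContinuousLinearMap.compL ℝ E E ℝ).flip (P m), ?_, fun m hm e ↦ ?_⟩
    · exact contMDiffOn_clm_of_apply fun ξ ↦
        contMDiffOn_const.prodMk_space (contMDiffOn_const.clm_comp hP)
    · have hmap (e : RT F E i m) : pmap i m e = 0 ↔ tanCoord m₀ m e.1 = 0 ∧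
          (cotCoord (i m₀) (i m) e.2).comp (dCoord F E i m₀ m) = 0 := by
        rw [← (gtCoord_injective (hVU hm).1).eq_iff, gtCoord_pmap (hVU hm), map_zero,
          pmapCoord_apply, Prod.mk_eq_zero, rtCoord_apply]
      rw [LinearMap.mem_ker, hmap]
      constructor
      · rintro ⟨h1, h2⟩
        refine ⟨cotCoord (i m₀) (i m) e.2, Prod.ext h1.symm (ContinuousLinearMap.ext fun v ↦ ?_)⟩
        have h3 := congrArg (fun T : F →L[ℝ] ℝ ↦ T (R m v)) h2
        change cotCoord (i m₀) (i m) e.2 (v - dCoord F E i m₀ m (R m v)) =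
          cotCoord (i m₀) (i m) e.2 v
        rw [map_sub]
        exact sub_eq_self.2 h3
      · rintro ⟨ξ, hξ⟩
        have h1 : (0 : F) = tanCoord m₀ m e.1 := congrArg Prod.fst hξ
        have h2 : ξ.comp (P m) = cotCoord (i m₀) (i m) e.2 := congrArg Prod.snd hξ
        refine ⟨h1.symm, ?_⟩
        rw [← h2]
        refine ContinuousLinearMap.ext fun u ↦ ?_
        change ξ (dCoord F E i m₀ m u - dCoord F E i m₀ m (R m (dCoord F E i m₀ m u))) = 0
        rw [hRD m hm, sub_self, map_zero]

/-- `L_J(M)` is a subbundle if the elements of `TM ⊕ T*M` have unique lifts to the `J`-invariant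
part of `TM ⊕ T*X|_M`. -/
lemma IsLift.isSubbundle_LM (hi : ContMDiff 𝓘(ℝ, F) 𝓘(ℝ, E) ∞ i)
    (hd : ∀ m, Function.Injective (dmap F E i m)) (hJ : IsSOSection J)
    (hJ2 : ∀ x, J x * J x = -1) {σ : ∀ m : M, GT F m →ₗ[ℝ] RT F E i m} (hσ : IsLift i J σ)
    (hK : ∀ (m : M) (e e' : RT F E i m), J (i m) (incl i m e) = incl i m e' → pmap i m e = 0 →
      e = 0) :
    IsSubbundle i (LM F i J) := by
  have hmem (m) (e : RT F E i m) : e ∈ LinearMap.range (σ m) ↔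
      ∃ e' : RT F E i m, J (i m) (incl i m e) = incl i m e' := by
    constructor
    · rintro ⟨ε, rfl⟩
      exact hσ.mem m ε
    · rintro ⟨e', he'⟩
      obtain ⟨e'', he''⟩ := hσ.mem m (pmap i m e)
      have h := hK m (e - σ m (pmap i m e)) (e' - e'')
        (by rw [map_sub, map_sub, he', he'', map_sub]) (by rw [map_sub, hσ.pmap_apply, sub_self])
      exact ⟨_, (sub_eq_zero.1 h).symm⟩
  refine isSubbundle_of_spanning (A := F × (F →L[ℝ] ℝ)) (Q := fun m ↦ LinearMap.range (σ m))
    hi hd hJ hJ2 (fun m a b ↦ ?_) (fun m a ha ↦ ?_) (fun m m' ↦ ?_) fun m₀ ↦ ?_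
  · rw [cplx_mem_LM hJ2, hmem]
    exact ⟨fun h ↦ ⟨⟨b, h⟩, h⟩, fun h ↦ h.2⟩
  · obtain ⟨b, hb⟩ := (hmem m a).1 ha
    exact ⟨b, (hmem m b).2 ⟨-a, by rw [← hb, apply_apply_of_sq (hJ2 _), map_neg]⟩, hb⟩
  · have hinj (m) : Function.Injective (σ m) :=
      Function.LeftInverse.injective (g := pmap i m) (hσ.pmap_apply m)
    rw [LinearMap.finrank_range_of_inj (hinj m), LinearMap.finrank_range_of_inj (hinj m'),
      finrank_GT, finrank_GT]
  · obtain ⟨V, hVU, hV, hm₀V, B, hB, hσB⟩ := hσ.exists_smooth hi hd hJ hK m₀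
    refine ⟨V, hVU, hV, hm₀V, B, hB, fun m hm e ↦ ⟨?_, ?_⟩⟩
    · rintro ⟨ε, rfl⟩
      exact ⟨_, (hσB m hm ε).symm⟩
    · rintro ⟨α, hα⟩
      refine ⟨gtFrame m₀ m α, rtCoord_injective (hVU hm) ?_⟩
      rw [hσB m hm, gtCoord_gtFrame (hVU hm).1, hα]

/-- `L_J(N*)` is a subbundle if it vanishes. -/
lemma isSubbundle_LN_of_eq_zero (hd : ∀ m, Function.Injective (dmap F E i m))
    (hJ2 : ∀ x, J x * J x = -1)
    (hK : ∀ (m : M) (e e' : RT F E i m), J (i m) (incl i m e) = incl i m e' → pmap i m e = 0 →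
      e = 0) :
    IsSubbundle i (LN F i J) := by
  refine fun m₀ ↦ ⟨Set.univ, isOpen_univ, trivial, 0, Fin.elim0, Fin.elim0, fun j ↦ j.elim0,
    fun j ↦ j.elim0, fun m _ ↦ ⟨linearIndependent_empty_type, ?_⟩⟩
  rw [Set.range_eq_empty, Submodule.span_empty, eq_comm, Submodule.eq_bot_iff]
  intro z hz
  obtain ⟨a, b, rfl⟩ := exists_cplx z
  obtain ⟨h1, h2, h3⟩ := (cplx_mem_LN (hd m) hJ2).1 hz
  have h4 := hK m a b h1 h2
  rw [h4, map_zero, map_zero] at h1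
  rw [h4, incl_injective (hd m) (h1.symm.trans (map_zero _).symm), cplx_zero]

/-! ## The induced generalized Kähler structure -/

/-- A related pair is a vector of TM ⊕ T*X|_M seen through the inclusion and through p, so this is
the defining property of the induced structure, in the form needed for brackets. -/
lemma apply_of_related (hJ2 : ∀ x, J x * J x = -1) {JM : EndField F M} (hJM : IsInduced i J JM)
    {m : M} {z w : GT E (i m)} {z' w' : GT F m} (hz : Related i m z z') (hw : Related i m w w')
    (h : J (i m) z = w) : JM m z' = w' := by
  have hincl {e : GT E (i m)} {e' : GT F m} (he : Related i m e e') :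
      incl i m (e'.1, e.2) = e ∧ pmap i m (e'.1, e.2) = e' :=
    ⟨Prod.ext he.1.symm rfl, Prod.ext rfl he.2⟩
  rw [← (hincl hz).2, ← (hincl hw).2]
  refine (isInduced_iff hJ2).1 hJM m _ _ ?_
  rw [(hincl hz).1, (hincl hw).1, h]

/-- A structure on `TM ⊕ T*M` intertwined with a generalized complex structure by isometric smooth
lifts is a generalized complex structure. -/
lemma isGeneralizedComplex_of_intertwines (hi : Manifold.IsImmersion 𝓘(ℝ, F) 𝓘(ℝ, E) ∞ i)
    (hJ : IsGeneralizedComplex J) {σ : ∀ m : M, GT F m →ₗ[ℝ] RT F E i m}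
    (hσp : ∀ m ε, pmap i m (σ m ε) = ε)
    (hσ : ∀ (U : Set M) (s : ∀ m, GT F m), SmoothGT U s → SmoothRT i U (fun m ↦ σ m (s m)))
    {JM : EndField F M} (hind : IsInduced i J JM) (hJM : Intertwines i σ J JM) :
    IsGeneralizedComplex JM := by
  have hd := dmap_injective hi
  have hinj {m} {ε ε' : GT F m} (h : incl i m (σ m ε) = incl i m (σ m ε')) : ε = ε' := by
    rw [← hσp m ε, incl_injective (hd m) h, hσp]
  have hsq (m) : JM m * JM m = -1 := by
    refine LinearMap.ext fun ε ↦ hinj ?_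
    rw [Module.End.mul_apply, ← hJM, ← hJM, apply_apply_of_sq (hJ.sq _)]
    simp
  have hsmooth (U : Set M) (s : ∀ m, GT F m) (hs : SmoothGT U s) :
      SmoothGT U (fun m ↦ JM m (s m)) := by
    have h := ((hσ U s hs).apply hi.contMDiff hd hJ.so fun m _ ↦ hJM m (s m)).pmap hi.contMDiff
    simpa only [hσp] using h
  refine ⟨⟨fun m ε ε' ↦ ?_, fun m ↦ det_eq_one_of_sq (hsq m) ?_, fun U _ s ↦ hsmooth U s⟩, hsq, ?_⟩
  · have h := hJ.so.orthogonal (i m) (incl i m (σ m ε)) (incl i m (σ m ε'))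
    rwa [hJM, hJM, pairing_incl, pairing_incl, hσp, hσp, hσp, hσp] at h
  · rw [finrank_GT]
    exact even_two_mul _
  · intro U hU a b c d ha hb hc hd' hab hcd m₀ hm₀
    obtain ⟨O, V, hO, hV, hm₀V, hVU, hVO, hext⟩ := exists_extension hi hU hm₀
    obtain ⟨a', ha', haa'⟩ := hext _ (hσ U a ha)
    obtain ⟨c', hc', hcc'⟩ := hext _ (hσ U c hc)
    -- Only the real parts a, c are extended. Taking J a' and J c' as imaginary parts gives sections
    -- of L_J on all of O, not just along M, and they are still related to b and d because σ
    -- intertwines J and J_M.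
    have hb' := hJ.so.smooth O hO a' ha'
    have hd'' := hJ.so.smooth O hO c' hc'
    have hrel (m) (ε : GT F m) : Related i m (incl i m (σ m ε)) ε := by
      have h := hσp m ε
      rw [pmap_apply, Prod.ext_iff] at h
      exact ⟨congrArg (dmap F E i m) h.1, h.2⟩
    have hra : ∀ m ∈ V, Related i m (a' (i m)) (a m) := fun m hm ↦ haa' m hm ▸ hrel m _
    have hrc : ∀ m ∈ V, Related i m (c' (i m)) (c m) := fun m hm ↦ hcc' m hm ▸ hrel m _
    have hrb : ∀ m ∈ V, Related i m (J (i m) (a' (i m))) (b m) := fun m hm ↦ by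
      rw [haa' m hm, hJM, (cplx_mem_eigenspace (hsq m)).1 (hab m (hVU hm))]
      exact hrel m _
    have hrd : ∀ m ∈ V, Related i m (J (i m) (c' (i m))) (d m) := fun m hm ↦ by
      rw [hcc' m hm, hJM, (cplx_mem_eigenspace (hsq m)).1 (hcd m (hVU hm))]
      exact hrel m _
    have hinv := hJ.involutive O hO a' _ c' _ ha' hb' hc' hd''
      (fun x _ ↦ (cplx_mem_eigenspace (hJ.sq x)).2 rfl)
      (fun x _ ↦ (cplx_mem_eigenspace (hJ.sq x)).2 rfl) (i m₀) (hVO m₀ hm₀V)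
    have hac := courant_of_related hi.contMDiff hV hm₀V hO (hVO m₀ hm₀V)
      ha' hc' (ha.mono hVU) (hc.mono hVU) hra hrc
    have hbd := courant_of_related hi.contMDiff hV hm₀V hO (hVO m₀ hm₀V)
      hb' hd'' (hb.mono hVU) (hd'.mono hVU) hrb hrd
    have had := courant_of_related hi.contMDiff hV hm₀V hO (hVO m₀ hm₀V)
      ha' hd'' (ha.mono hVU) (hd'.mono hVU) hra hrd
    have hbc := courant_of_related hi.contMDiff hV hm₀V hO (hVO m₀ hm₀V)
      hb' hc' (hb.mono hVU) (hc.mono hVU) hrb hrc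
    refine (cplx_mem_eigenspace (hsq m₀)).2 ?_
    exact apply_of_related hJ.sq hind (hac.sub hbd) (had.add hbc)
      ((cplx_mem_eigenspace (hJ.sq _)).1 hinv)

end Subbundles

/-! ### Transfer of the Kähler conditions to the submanifold. -/

section Kahler

variable {E : Type*} [NormedAddCommGroup E] [NormedSpace ℝ E]
  {X : Type*} [TopologicalSpace X] [ChartedSpace E X] [IsManifold 𝓘(ℝ, E) ∞ X]

lemma IsSOSection.mul {A B : EndField E X} (hA : IsSOSection A) (hB : IsSOSection B) :
    IsSOSection (fun x ↦ A x * B x) where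
  orthogonal x e₁ e₂ := (hA.orthogonal x _ _).trans (hB.orthogonal x e₁ e₂)
  det_eq_one x := by rw [map_mul, hA.det_eq_one, hB.det_eq_one, one_mul]
  smooth U hU s hs := hA.smooth U hU _ (hB.smooth U hU s hs)

/-- Writing -A B as A² A B makes it a product of sections of SO, so no separate treatment of the
sign is needed. -/
lemma IsGeneralizedComplex.neg_mul {A B : EndField E X} (hA : IsGeneralizedComplex A)
    (hB : IsSOSection B) : IsSOSection (fun x ↦ -(A x * B x)) := by
  have h : (fun x ↦ -(A x * B x)) = fun x ↦ (A x * A x) * (A x * B x) :=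
    funext fun x ↦ LinearMap.ext fun e ↦ (apply_apply_of_sq (hA.sq x) (A x (B x e))).symm
  rw [h]
  exact (hA.so.mul hA.so).mul (hA.so.mul hB)

variable {F : Type*} [NormedAddCommGroup F] [NormedSpace ℝ F]
  {M : Type*} [TopologicalSpace M] [ChartedSpace F M] [IsManifold 𝓘(ℝ, F) ∞ M]
  {i : M → X} {J J₀ J₁ : EndField E X} {J₀M J₁M : EndField F M}
  {σ : ∀ m : M, GT F m →ₗ[ℝ] RT F E i m}

/-- Generalized complex structures intertwined with those of a generalized Kähler structure by
isometric lifts form a generalized Kähler structure. -/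
lemma isGeneralizedKahler_of_intertwines (hd : ∀ m, Function.Injective (dmap F E i m))
    (hJ : IsGeneralizedKahler J₀ J₁) (hσ : IsLift i J σ)
    (h₀ : IsGeneralizedComplex J₀M) (h₁ : IsGeneralizedComplex J₁M)
    (hσ₀ : Intertwines i σ J₀ J₀M) (hσ₁ : Intertwines i σ J₁ J₁M) :
    IsGeneralizedKahler J₀M J₁M := by
  have hcomm (m) : J₀M m * J₁M m = J₁M m * J₀M m := by
    refine LinearMap.ext fun ε ↦ hσ.injective (hd m) ?_
    rw [Module.End.mul_apply, Module.End.mul_apply, ← hσ₀, ← hσ₁, ← hσ₁, ← hσ₀]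
    exact LinearMap.congr_fun (hJ.comm (i m)) _
  -- The form ⟨G ·, ·⟩ on M is the restriction of the ambient one along σ; symmetry and positivity
  -- are inherited.
  have hG (m) (ε ε' : GT F m) : pairing ((-(J₀M m * J₁M m)) ε) ε' =
      pairing ((-(J₀ (i m) * J₁ (i m))) (incl i m (σ m ε))) (incl i m (σ m ε')) := by
    rw [← hσ.pairing_eq, LinearMap.neg_apply, LinearMap.neg_apply, Module.End.mul_apply,
      Module.End.mul_apply, map_neg, map_neg, ← hσ₀, ← hσ₁]
  refine ⟨h₀, h₁, hcomm, h₀.neg_mul h₁.so, fun m ↦ ?_, fun m ε ε' ↦ ?_, fun m ε hε ↦ ?_⟩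
  · refine LinearMap.ext fun ε ↦ ?_
    have h := LinearMap.congr_fun (hcomm m) (J₁M m ε)
    change -(J₀M m (J₁M m (-(J₀M m (J₁M m ε))))) = ε
    change J₀M m (J₁M m (J₁M m ε)) = J₁M m (J₀M m (J₁M m ε)) at h
    rw [map_neg, map_neg, neg_neg, ← h, apply_apply_of_sq (h₁.sq m), map_neg, map_neg,
      apply_apply_of_sq (h₀.sq m), neg_neg]
  · rw [hG, hG, hJ.metric.symm]
  · rw [hG]
    refine hJ.metric.pos _ _ fun h ↦ hε (hσ.injective (hd m) ?_)
    rw [h, map_zero, map_zero]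

end Kahler

end GenKahler

end

/-! ### The main theorem. -/

theorem theorem1p9
    {E : Type*} [NormedAddCommGroup E] [NormedSpace ℝ E] [FiniteDimensional ℝ E]
    {X : Type*} [TopologicalSpace X] [ChartedSpace E X] [IsManifold 𝓘(ℝ, E) ∞ X]
    {F : Type*} [NormedAddCommGroup F] [NormedSpace ℝ F] [FiniteDimensional ℝ F]
    {M : Type*} [TopologicalSpace M] [ChartedSpace F M] [IsManifold 𝓘(ℝ, F) ∞ M]
    (i : M → X) (hi : Manifold.IsImmersion 𝓘(ℝ, F) 𝓘(ℝ, E) ∞ i)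
    (J₀ J₁ : GenKahler.EndField E X) (hJ : GenKahler.IsGeneralizedKahler J₀ J₁)
    (hN : GenKahler.ConormalInvariant F i J₀) :
    GenKahler.IsGKSubmanifold (F := F) i J₀ J₁ ∧
      (∃! J₀M : GenKahler.EndField F M, GenKahler.IsInduced i J₀ J₀M) ∧
      (∃! J₁M : GenKahler.EndField F M, GenKahler.IsInduced i J₁ J₁M) ∧
      ∀ J₀M J₁M : GenKahler.EndField F M,
        GenKahler.IsInduced i J₀ J₀M → GenKahler.IsInduced i J₁ J₁M →
          GenKahler.IsGeneralizedKahler J₀M J₁M := by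
  have hd := GenKahler.dmap_injective hi
  have h₀ := hJ.complex₀
  have h₁ := hJ.complex₁
  have hD₀ := GenKahler.descends_of_conormalInvariant hd h₀.so.orthogonal hN
  have hD₁ := GenKahler.descends_of_kahler hd hJ hN
  have hR (m : M) (e : GenKahler.RT F E i m) :=
    GenKahler.exists_incl_of_conormalInvariant h₀.so.orthogonal hN e
  have hK (m : M) (e e' : GenKahler.RT F E i m)
      (he : J₁ (i m) (GenKahler.incl i m e) = GenKahler.incl i m e')
      (hp : GenKahler.pmap i m e = 0) : e = 0 :=
    GenKahler.eq_zero_of_conormal (hd m) hJ hN he hp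
  -- The lift for J₁ serves both structures: unlike lifts for J₀ alone, it is unique, hence smooth,
  -- and it intertwines J₀ as well.
  obtain ⟨σ, hσ⟩ := hD₁.exists_isLift
  have hσs (U : Set M) (s : ∀ m, GenKahler.GT F m) (hs : GenKahler.SmoothGT U s) :=
    hσ.smoothRT hi.contMDiff hd h₁.so hK hs
  refine ⟨⟨⟨?_, ?_, fun m ↦ hD₀.exact_middle (hd m) h₀.sq, hD₀.surjective h₀.sq⟩,
    ⟨?_, ?_, fun m ↦ hD₁.exact_middle (hd m) h₁.sq, hD₁.surjective h₁.sq⟩⟩,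
    hD₀.existsUnique_isInduced hd h₀.sq, hD₁.existsUnique_isInduced hd h₁.sq,
    fun J₀M J₁M hJ₀M hJ₁M ↦ ?_⟩
  · exact GenKahler.isSubbundle_LM_of_invariant hi.contMDiff hd h₀.so h₀.sq hR
  · exact GenKahler.isSubbundle_LN_of_invariant hi.contMDiff hd h₀.so h₀.sq hD₀ hR
  · exact hσ.isSubbundle_LM hi.contMDiff hd h₁.so h₁.sq hK
  · exact GenKahler.isSubbundle_LN_of_eq_zero hd h₁.sq hK
  · have hσ₀ := GenKahler.intertwines₀ hd hJ hN hσ hJ₀M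
    have hσ₁ := GenKahler.intertwines₁ hd hJ hN hσ hJ₁M
    exact GenKahler.isGeneralizedKahler_of_intertwines hd hJ hσ
      (GenKahler.isGeneralizedComplex_of_intertwines hi h₀ hσ.pmap_apply hσs hJ₀M hσ₀)
      (GenKahler.isGeneralizedComplex_of_intertwines hi h₁ hσ.pmap_apply hσs hJ₁M hσ₁) hσ₀ hσ₁
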